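/- Let $A$ be a (not necessarily unital) $C^*$-algebra, $\alpha:A\to A$ an endomorphism ($*$-homomorphism), and $J$ a closed two-sided ideal in $A$. **Definitions.** A *representation* of $(A,\alpha)$ is a pair $(\pi,S)$ of a non-degenerate representation $\pi:A\to B(H)$ and $S\in B(H)$ with $S^*\pi(a)S=\pi(\alpha(a))$ for all $a\in A$; put $C^*(\pi,S):=C^*(\pi(A)\cup\pi(A)S)$. A pair $(\pi(a),k)$ with $k\in\overline{\pi(A)S\pi(A)S^*\pi(A)}$ (closed linear span) is a *redundancy* of $(\pi,S)$ if $\pi(a)\pi(b)S=k\,\pi(b)S$ for all $b\in A$, and $J_{(\pi,S)}:=\{a\in A: (\pi(a),\pi(a)) \text{ is a redundancy}\}$. Let $X_\alpha$ be the $C^*$-correspondence over $A$ obtained as the Hausdorff completion of $A\odot A$ with respect to $\langle a\odot b,c\odot d\rangle=b^*\alpha(a^*c)d$, with actions $a\cdot(b\otimes c)\cdot d=(ab)\otimes(cd)$ and left action $\phi:A\to\mathcal L(X_\alpha)$, and let $J(X_\alpha)=\phi^{-1}(\mathcal K(X_\alpha))$. The representation $(\pi,S)$ is *$J$-covariant*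 if $J\cap J(X_\alpha)\subseteq J_{(\pi,S)}$. A representation in a class of pairs $(\pi,T)$ is *universal* for the class if for each $(\pi',T')$ in the class the assignments $\pi(a)\mapsto\pi'(a)$, $T\mapsto T'$ extend to a homomorphism $C^*(\pi(A)\cup\{T\})\to C^*(\pi'(A)\cup\{T'\})$. Let $(i_A,t)$ be the universal representation of $(A,\alpha)$ and $\mathcal T(A,\alpha)=C^*(i_A,t)$. The *relative crossed product* $C^*(A,\alpha;J)$ is the quotient of $\mathcal T(A,\alpha)$ by the closed ideal generated by $\{i_A(a)-k: a\in J,\ (i_A(a),k)\text{ a redundancy of }(i_A,t)\}$; $j_A(a)$ and $j_A(a)s$ denote the classes of $i_A(a)$ and $i_A(a)t$, and $(j_A,s)$ a representation of $(A,\alpha)$ that generates $C^*(A,\alpha;J)$ in this way, i.e. $C^*(j_A,s)\cong C^*(A,\alpha;J)$ compatibly with these elements. Put $I^\perp=\{a\in A: aI=0\}$ and $C^*(A,\alpha)=C^*(A,\alpha;N_\alpha^\perp)$, where $N_\alpha=\{a:\alpha((ab)^*ab)=0\ \forall b\in A\}$ (so $N_\alpha=\ker\alpha$). A *representation of the endomorphism*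 $\alpha$ is a pair $(\pi,U)$ with $\pi$ non-degenerate and $U\pi(a)U^*=\pi(\alpha(a))$ for all $a$. With $(i_A,u)$ denoting in each case the universal representation of the indicated kind: $C^*_{endo}(A,\alpha;J)=C^*(i_A(A)\cup i_A(A)u)$ for those with $J\subseteq\{a:U^*U\pi(a)=\pi(a)\}$, and $C^*_{endo}(A,\alpha)=C^*_{endo}(A,\alpha;(\ker\alpha)^\perp)$; *Stacey's crossed product* is $A\rtimes^1_\alpha\mathbb N=C^*(\{i_A(a)u^nu^{*m}:a\in A,\ n,m\ge 0\})$ for those with $U$ an isometry; the *partial-isometric crossed product* is $A\rtimes_\alpha\mathbb N=C^*(i_A(A)\cup u\,i_A(A))$ for those with $U$ a partial isometry and $U^*U\in\pi(A)'$. Finally, $\alpha$ is *extendible* if it extends to a strictly continuous map $M(A)\to M(A)$ of the multiplier algebra. **Proposition.** 1. A representation $(\pi,S)$ of $(A,\alpha)$ is $J$-covariant if and only if $$J\subseteq\{a\in A: SS^*\pi(a)=\pi(a)\}.\qquad(*)$$ 2. The $C^*$-algebra $C^*(A,\alpha;J)$ is generated by $j_A(A)\cup j_A(A)s$, where $(j_A,s)$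 is a universal representation for the representations of $(A,\alpha)$ satisfying $(*)$. That is: a universal representation for this class exists, and each such universal representation generates $C^*(A,\alpha;J)$; every representation generating $C^*(A,\alpha;J)$ satisfies $(*)$; and for each representation $(\pi,S)$ satisfying $(*)$ the assignments $j_A(a)\mapsto\pi(a)$, $j_A(a)s\mapsto\pi(a)S$ extend to a unique homomorphism $C^*(A,\alpha;J)\to C^*(\pi,S)$. 3. If $\alpha$ is extendible, then $s\in M(C^*(A,\alpha;J))$, $C^*(A,\alpha;J)$ is generated by $j_A(A)\cup s\,j_A(A)$, and the assignments $j_A(a)\mapsto i_A(a)$, $s\,j_A(a)\mapsto u^*i_A(a)$, $a\in A$, establish the isomorphisms $$C^*(A,\alpha;J)\cong C^*_{endo}(A,\alpha;J),\qquad C^*(A,\alpha)\cong C^*_{endo}(A,\alpha),$$ $$C^*(A,\alpha;A)\cong A\rtimes^1_\alpha\mathbb N,\qquad C^*(A,\alpha;\{0\})\cong A\rtimes_\alpha\mathbb N.$$ -/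

import Mathlib

open Filter Topology
open scoped MultiplierAlgebra

universe u v

/-! ### Quotients of `C⋆`-algebras by closed two-sided ideals -/

/-- A closed two-sided ideal of a `C⋆`-algebra. -/
structure ClosedIdeal (A : Type u) [NonUnitalCStarAlgebra A] where
  toTwoSidedIdeal : TwoSidedIdeal A
  isClosed : IsClosed (toTwoSidedIdeal : Set A)

instance {A : Type u} [NonUnitalCStarAlgebra A] : SetLike (ClosedIdeal A) A where
  coe I := I.toTwoSidedIdeal
  coe_injective := by
    rintro ⟨I, _⟩ ⟨J, _⟩ h
    cases SetLike.coe_injective h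
    rfl

namespace CStarAux

theorem norm_sub_mul_le {A : Type u} [NonUnitalCStarAlgebra A] [PartialOrder A] [StarOrderedRing A]
    (x : A) (hx : 0 ≤ x) (hn : ‖x‖ ≤ 1) (y : A) : ‖y - y * x‖ ≤ ‖y‖ := by
  have h0 : (0 : Unitization ℂ A) ≤ (x : Unitization ℂ A) := Unitization.inr_nonneg_iff.mpr hx
  have h1 : ‖(x : Unitization ℂ A)‖ ≤ 1 := by rwa [Unitization.norm_inr]
  have h2 : (x : Unitization ℂ A) ≤ 1 := (CStarAlgebra.norm_le_one_iff_of_nonneg _ h0).mp h1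
  have h3 : ‖(1 - x : Unitization ℂ A)‖ ≤ 1 :=
    (CStarAlgebra.norm_le_one_iff_of_nonneg _ (sub_nonneg.mpr h2)).mpr (sub_le_self _ h0)
  have h4 : ((y - y * x : A) : Unitization ℂ A) = (y : Unitization ℂ A) * (1 - x) := by
    simp [mul_sub]
  rw [← Unitization.norm_inr (𝕜 := ℂ) (y - y * x), h4]
  refine (norm_mul_le _ _).trans ?_
  rw [Unitization.norm_inr]
  exact mul_le_of_le_one_right (norm_nonneg _) h3

theorem exists_approx (A : Type u) [NonUnitalCStarAlgebra A] :
    ∃ l : Filter A, l.NeBot ∧ (∀ m : A, Tendsto (fun e => m * e) l (𝓝 m)) ∧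
      (∀ m : A, Tendsto (fun e => e * m) l (𝓝 m)) ∧
      ∀ᶠ e in l, star e = e ∧ ‖e‖ ≤ 1 ∧ ∀ y : A, ‖y - y * e‖ ≤ ‖y‖ := by
  let _ := CStarAlgebra.spectralOrder A
  have := CStarAlgebra.spectralOrderedRing A
  have h := CStarAlgebra.increasingApproximateUnit A
  refine ⟨_, h.neBot, h.tendsto_mul_left, h.tendsto_mul_right, ?_⟩
  filter_upwards [h.eventually_nonneg, h.eventually_norm] with e h1 h2
  exact ⟨(IsSelfAdjoint.of_nonneg h1).star_eq, h2, norm_sub_mul_le e h1 h2⟩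

end CStarAux

namespace ClosedIdeal

variable {A : Type u} [NonUnitalCStarAlgebra A]

theorem smul_mem (I : ClosedIdeal A) (c : ℂ) {x : A} (hx : x ∈ I.toTwoSidedIdeal) :
    c • x ∈ I.toTwoSidedIdeal := by
  obtain ⟨l, hl, hr, -, -⟩ := CStarAux.exists_approx A
  refine I.isClosed.mem_of_tendsto (hr (c • x)) (Eventually.of_forall fun e => ?_)
  rw [smul_mul_assoc, ← mul_smul_comm]
  exact I.toTwoSidedIdeal.mul_mem_right _ _ hx

/-- The underlying complex subspace of a closed ideal. -/
def toSubmodule (I : ClosedIdeal A) : Submodule ℂ A where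
  carrier := I.toTwoSidedIdeal
  add_mem' := I.toTwoSidedIdeal.add_mem
  zero_mem' := I.toTwoSidedIdeal.zero_mem
  smul_mem' c _ hx := I.smul_mem c hx

theorem mem_toSubmodule (I : ClosedIdeal A) {x : A} :
    x ∈ I.toSubmodule ↔ x ∈ I.toTwoSidedIdeal := Iff.rfl

/-- The `C⋆`-subalgebra `I ∩ I⋆`; by `star_mem` it is all of `I`. -/
def selfAdj (I : ClosedIdeal A) : NonUnitalStarSubalgebra ℂ A where
  carrier := {x | x ∈ I.toSubmodule ∧ star x ∈ I.toSubmodule}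
  add_mem' := by
    rintro a b ⟨h1, h2⟩ ⟨h3, h4⟩
    exact ⟨add_mem h1 h3, by rw [star_add]; exact add_mem h2 h4⟩
  zero_mem' := ⟨zero_mem _, by rw [star_zero]; exact zero_mem _⟩
  mul_mem' := by
    rintro a b ⟨h1, h2⟩ ⟨h3, h4⟩
    exact ⟨I.toTwoSidedIdeal.mul_mem_right _ _ h1,
      by rw [star_mul]; exact I.toTwoSidedIdeal.mul_mem_right _ _ h4⟩
  smul_mem' := by
    rintro c a ⟨h1, h2⟩
    exact ⟨Submodule.smul_mem _ _ h1, by rw [star_smul]; exact Submodule.smul_mem _ _ h2⟩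
  star_mem' := by
    rintro a ⟨h1, h2⟩
    exact ⟨h2, by rwa [star_star]⟩

theorem mem_selfAdj (I : ClosedIdeal A) {x : A} :
    x ∈ I.selfAdj ↔ x ∈ I.toSubmodule ∧ star x ∈ I.toSubmodule := Iff.rfl

theorem isClosed_selfAdj (I : ClosedIdeal A) : IsClosed (I.selfAdj : Set A) :=
  I.isClosed.inter (I.isClosed.preimage continuous_star)

theorem exists_approx (I : ClosedIdeal A) :
    ∃ l : Filter A, l.NeBot ∧ (∀ m ∈ I.selfAdj, Tendsto (fun e => m * e) l (𝓝 m)) ∧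
      ∀ᶠ e in l, e ∈ I.selfAdj ∧ star e = e ∧ ‖e‖ ≤ 1 ∧ ∀ y : A, ‖y - y * e‖ ≤ ‖y‖ := by
  have : IsClosed (I.selfAdj : Set A) := I.isClosed_selfAdj
  let _ := CStarAlgebra.spectralOrder A
  have := CStarAlgebra.spectralOrderedRing A
  let _ := CStarAlgebra.spectralOrder I.selfAdj
  have := CStarAlgebra.spectralOrderedRing I.selfAdj
  have h := CStarAlgebra.increasingApproximateUnit I.selfAdj
  have := h.neBot
  refine ⟨(CStarAlgebra.approximateUnit I.selfAdj).map Subtype.val, inferInstance, ?_, ?_⟩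
  · intro m hm
    exact tendsto_map'_iff.mpr ((continuous_subtype_val.tendsto _).comp
      (h.tendsto_mul_left ⟨m, hm⟩))
  · rw [eventually_map]
    filter_upwards [h.eventually_nonneg, h.eventually_norm] with e h1 h2
    have h3 : star (e : A) = e :=
      congrArg Subtype.val (IsSelfAdjoint.of_nonneg h1).star_eq
    have h4 : (0 : A) ≤ e := by
      obtain ⟨b, hb⟩ := CStarAlgebra.nonneg_iff_eq_star_mul_self.mp h1
      rw [hb]
      exact star_mul_self_nonneg (b : A)
    exact ⟨e.2, h3, h2, CStarAux.norm_sub_mul_le _ h4 h2⟩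

theorem star_mem (I : ClosedIdeal A) {x : A} (hx : x ∈ I.toTwoSidedIdeal) :
    star x ∈ I.toTwoSidedIdeal := by
  obtain ⟨l, hl, hr, he⟩ := I.exists_approx
  have hxx : x * star x ∈ I.selfAdj :=
    ⟨I.toTwoSidedIdeal.mul_mem_right _ _ hx,
      by rw [star_mul, star_star]; exact I.toTwoSidedIdeal.mul_mem_right _ _ hx⟩
  have h1 : Tendsto (fun e => ‖x * star x - x * star x * e‖) l (𝓝 0) := by
    have := (tendsto_const_nhds (x := x * star x)).sub (hr _ hxx)
    simpa using this.norm
  have h2 : Tendsto (fun e => ‖star x - star x * e‖ ^ 2) l (𝓝 0) := by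
    refine squeeze_zero' (Eventually.of_forall fun e => by positivity) ?_
      (by simpa using h1.const_mul 2)
    filter_upwards [he] with e ⟨_, h3, h4, _⟩
    have : star (star x - star x * e) * (star x - star x * e)
        = (x * star x - x * star x * e) - e * (x * star x - x * star x * e) := by
      simp only [star_sub, star_mul, star_star, h3]
      noncomm_ring
    rw [sq, ← CStarRing.norm_star_mul_self, this]
    refine (norm_sub_le _ _).trans ?_
    have := norm_mul_le e (x * star x - x * star x * e)
    nlinarith [norm_nonneg (x * star x - x * star x * e)]
  have h3 : Tendsto (fun e => star x * e) l (𝓝 (star x)) := by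
    rw [tendsto_iff_norm_sub_tendsto_zero]
    have := h2.sqrt
    simp only [Real.sqrt_zero, Real.sqrt_sq (norm_nonneg _)] at this
    simpa [norm_sub_rev] using this
  refine I.isClosed.mem_of_tendsto h3 ?_
  filter_upwards [he] with e ⟨h4, _⟩
  exact I.toTwoSidedIdeal.mul_mem_left _ _ h4.1

/-- The quotient of a `C⋆`-algebra by a closed two-sided ideal. -/
def QuotAlg (I : ClosedIdeal A) : Type u := A ⧸ I.toSubmodule

namespace QuotAlg

variable (I : ClosedIdeal A)

instance : IsClosed (I.toSubmodule : Set A) := I.isClosed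

/-- The norm is the quotient norm. -/
noncomputable instance : NormedAddCommGroup I.QuotAlg :=
  inferInstanceAs (NormedAddCommGroup (A ⧸ I.toSubmodule))

noncomputable instance : NormedSpace ℂ I.QuotAlg :=
  inferInstanceAs (NormedSpace ℂ (A ⧸ I.toSubmodule))

instance : CompleteSpace I.QuotAlg :=
  inferInstanceAs (CompleteSpace (A ⧸ I.toSubmodule))

/-- The quotient map. -/
def mk : A →ₗ[ℂ] I.QuotAlg := I.toSubmodule.mkQ

theorem mk_surjective : Function.Surjective (mk I) := I.toSubmodule.mkQ_surjective

theorem mk_eq_mk {x y : A} : mk I x = mk I y ↔ x - y ∈ I.toTwoSidedIdeal :=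
  Submodule.Quotient.eq I.toSubmodule

instance : Mul I.QuotAlg where
  mul := Quotient.map₂ (· * ·) (by
    intro a b hab c d hcd
    have h1 : a - b ∈ I.toTwoSidedIdeal := (Submodule.quotientRel_def _).mp hab
    have h2 : c - d ∈ I.toTwoSidedIdeal := (Submodule.quotientRel_def _).mp hcd
    refine (Submodule.quotientRel_def _).mpr ?_
    have : a * c - b * d = (a - b) * c + b * (c - d) := by noncomm_ring
    rw [this]
    exact I.toTwoSidedIdeal.add_mem (I.toTwoSidedIdeal.mul_mem_right _ _ h1)
      (I.toTwoSidedIdeal.mul_mem_left _ _ h2))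

instance : Star I.QuotAlg where
  star := Quotient.map star (by
    intro a b hab
    have h1 : a - b ∈ I.toTwoSidedIdeal := (Submodule.quotientRel_def _).mp hab
    refine (Submodule.quotientRel_def _).mpr ?_
    have := I.star_mem h1
    rwa [star_sub] at this)

theorem mk_mul (x y : A) : mk I (x * y) = mk I x * mk I y := rfl

theorem mk_star (x : A) : mk I (star x) = star (mk I x) := rfl

noncomputable instance : NonUnitalRing I.QuotAlg where
  left_distrib x y z := by
    obtain ⟨x, rfl⟩ := mk_surjective I x
    obtain ⟨y, rfl⟩ := mk_surjective I y
    obtain ⟨z, rfl⟩ := mk_surjective I z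
    rw [← map_add, ← mk_mul, ← mk_mul, ← mk_mul, ← map_add, mul_add]
  right_distrib x y z := by
    obtain ⟨x, rfl⟩ := mk_surjective I x
    obtain ⟨y, rfl⟩ := mk_surjective I y
    obtain ⟨z, rfl⟩ := mk_surjective I z
    rw [← map_add, ← mk_mul, ← mk_mul, ← mk_mul, ← map_add, add_mul]
  zero_mul x := by
    obtain ⟨x, rfl⟩ := mk_surjective I x
    rw [← map_zero (mk I), ← mk_mul, zero_mul]
  mul_zero x := by
    obtain ⟨x, rfl⟩ := mk_surjective I x
    rw [← map_zero (mk I), ← mk_mul, mul_zero]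
  mul_assoc x y z := by
    obtain ⟨x, rfl⟩ := mk_surjective I x
    obtain ⟨y, rfl⟩ := mk_surjective I y
    obtain ⟨z, rfl⟩ := mk_surjective I z
    simp only [← mk_mul, mul_assoc]

theorem norm_mk_le (x : A) : ‖mk I x‖ ≤ ‖x‖ := Submodule.Quotient.norm_mk_le _ _

theorem exists_norm_lt (x : I.QuotAlg) {ε : ℝ} (hε : 0 < ε) : ∃ a : A, mk I a = x ∧ ‖a‖ < ‖x‖ + ε :=
  Submodule.Quotient.norm_mk_lt x hε

noncomputable instance : NonUnitalNormedRing I.QuotAlg where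
  dist_eq := NormedAddCommGroup.dist_eq
  norm_mul_le x y := by
    have key : ∀ ε > 0, ‖x * y‖ ≤ (‖x‖ + ε) * (‖y‖ + ε) := by
      intro ε hε
      obtain ⟨a, rfl, ha⟩ := exists_norm_lt I x hε
      obtain ⟨b, rfl, hb⟩ := exists_norm_lt I y hε
      rw [← mk_mul]
      refine (norm_mk_le I _).trans ((norm_mul_le a b).trans ?_)
      gcongr
    have h1 : Tendsto (fun ε : ℝ => (‖x‖ + ε) * (‖y‖ + ε)) (𝓝[>] 0) (𝓝 (‖x‖ * ‖y‖)) := by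
      have : Tendsto (fun ε : ℝ => (‖x‖ + ε) * (‖y‖ + ε)) (𝓝 0)
          (𝓝 ((‖x‖ + 0) * (‖y‖ + 0))) := Continuous.tendsto (by fun_prop) 0
      simp only [add_zero] at this
      exact this.mono_left nhdsWithin_le_nhds
    exact ge_of_tendsto h1 (by filter_upwards [self_mem_nhdsWithin] with ε hε using key ε hε)

noncomputable instance : StarRing I.QuotAlg where
  star_involutive x := by
    obtain ⟨x, rfl⟩ := mk_surjective I x
    rw [← mk_star, ← mk_star, star_star]
  star_mul x y := by
    obtain ⟨x, rfl⟩ := mk_surjective I x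
    obtain ⟨y, rfl⟩ := mk_surjective I y
    simp only [← mk_star, ← mk_mul, star_mul]
  star_add x y := by
    obtain ⟨x, rfl⟩ := mk_surjective I x
    obtain ⟨y, rfl⟩ := mk_surjective I y
    simp only [← mk_star, ← map_add, star_add]

theorem norm_mul_self_le (x : I.QuotAlg) : ‖x‖ * ‖x‖ ≤ ‖star x * x‖ := by
  obtain ⟨a, rfl⟩ := mk_surjective I x
  rw [← mk_star, ← mk_mul]
  refine le_of_forall_pos_le_add fun ε hε => ?_
  obtain ⟨b, hb, hbn⟩ := exists_norm_lt I (mk I (star a * a)) hε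
  have hi : star a * a - b ∈ I.toTwoSidedIdeal := (mk_eq_mk I).mp hb.symm
  have hi' : star a * a - b ∈ I.selfAdj := ⟨hi, I.star_mem hi⟩
  obtain ⟨l, hl, hr, he⟩ := I.exists_approx
  have h1 : Tendsto (fun e => ‖(star a * a - b) - (star a * a - b) * e‖) l (𝓝 0) := by
    have := (tendsto_const_nhds (x := star a * a - b)).sub (hr _ hi')
    simpa using this.norm
  have h2 : Tendsto (fun e => ‖b‖ + 2 * ‖(star a * a - b) - (star a * a - b) * e‖) l
      (𝓝 (‖b‖ + 2 * 0)) := (h1.const_mul 2).const_add _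
  have h3 : ‖mk I a‖ * ‖mk I a‖ ≤ ‖b‖ := by
    simp only [mul_zero, add_zero] at h2
    refine ge_of_tendsto h2 ?_
    filter_upwards [he] with e ⟨h4, h5, h6, h7⟩
    have h8 : mk I a = mk I (a - a * e) := by
      rw [mk_eq_mk, sub_sub_cancel]
      exact I.toTwoSidedIdeal.mul_mem_left _ _ h4.1
    have h9 : star (a - a * e) * (a - a * e) = star (star (b - b * e) - star (b - b * e) * e)
        + ((star a * a - b - (star a * a - b) * e)
          - e * (star a * a - b - (star a * a - b) * e)) := by
      simp only [star_sub, star_mul, star_star, h5]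
      noncomm_ring
    have h10 : ‖mk I a‖ ≤ ‖a - a * e‖ := by rw [h8]; exact norm_mk_le I _
    calc ‖mk I a‖ * ‖mk I a‖ ≤ ‖a - a * e‖ * ‖a - a * e‖ := by gcongr
      _ = ‖star (a - a * e) * (a - a * e)‖ := (CStarRing.norm_star_mul_self).symm
      _ ≤ ‖b‖ + (‖star a * a - b - (star a * a - b) * e‖
            + ‖e‖ * ‖star a * a - b - (star a * a - b) * e‖) := by
          rw [h9]
          refine (norm_add_le _ _).trans (add_le_add ?_ ?_)
          · rw [norm_star]
            refine (h7 _).trans ?_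
            rw [norm_star]
            exact h7 _
          · exact (norm_sub_le _ _).trans (add_le_add le_rfl (norm_mul_le _ _))
      _ ≤ _ := by nlinarith [norm_nonneg (star a * a - b - (star a * a - b) * e)]
  linarith

/-- The quotient of a `C⋆`-algebra by a closed two-sided ideal is a `C⋆`-algebra. -/
noncomputable instance : NonUnitalCStarAlgebra I.QuotAlg where
  norm_mul_self_le := norm_mul_self_le I
  smul_assoc c x y := by
    obtain ⟨x, rfl⟩ := mk_surjective I x
    obtain ⟨y, rfl⟩ := mk_surjective I y
    simp only [smul_eq_mul]
    rw [← map_smul, ← mk_mul, ← mk_mul, ← map_smul, smul_mul_assoc]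
  smul_comm c x y := by
    obtain ⟨x, rfl⟩ := mk_surjective I x
    obtain ⟨y, rfl⟩ := mk_surjective I y
    simp only [smul_eq_mul]
    rw [← map_smul, ← mk_mul, ← mk_mul, ← map_smul, mul_smul_comm]
  star_smul c x := by
    obtain ⟨x, rfl⟩ := mk_surjective I x
    rw [← map_smul, ← mk_star, ← mk_star, ← map_smul, star_smul]

end QuotAlg

/-- The smallest closed two-sided ideal containing a set. -/
def closedSpan (s : Set A) : ClosedIdeal A where
  toTwoSidedIdeal := sInf {I | IsClosed (I : Set A) ∧ s ⊆ I}
  isClosed := by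
    have : ((sInf {I : TwoSidedIdeal A | IsClosed (I : Set A) ∧ s ⊆ I} : TwoSidedIdeal A) : Set A)
        = ⋂ I ∈ {I : TwoSidedIdeal A | IsClosed (I : Set A) ∧ s ⊆ I}, (I : Set A) := by
      ext x
      simp only [SetLike.mem_coe, TwoSidedIdeal.mem_sInf, Set.mem_iInter]
    rw [this]
    exact isClosed_biInter fun I hI => hI.1

end ClosedIdeal

/-! ### Pairs `(π, T)`, the preorder on them, and universal pairs -/

/-- The `C⋆`-subalgebra `C⋆(s)` generated by a set `s`. -/
noncomputable def cstarGen {B : Type v} [NonUnitalCStarAlgebra B] (s : Set B) : NonUnitalStarSubalgebra ℂ B :=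
  (NonUnitalStarAlgebra.adjoin ℂ s).topologicalClosure

theorem subset_cstarGen {B : Type v} [NonUnitalCStarAlgebra B] (s : Set B) :
    s ⊆ cstarGen s :=
  (NonUnitalStarAlgebra.subset_adjoin ℂ s).trans
    (NonUnitalStarSubalgebra.le_topologicalClosure _)

instance isClosed_cstarGen {B : Type v} [NonUnitalCStarAlgebra B] (s : Set B) :
    IsClosed (cstarGen s : Set B) :=
  NonUnitalStarSubalgebra.isClosed_topologicalClosure _

/-- A pair `(π, T)` of a non-degenerate representation `π` of `A` on a Hilbert space `H`
and a bounded operator `T` on `H`. -/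
structure OpRep (A : Type u) [NonUnitalCStarAlgebra A] : Type (max u (v + 1)) where
  H : Type v
  [normedAddCommGroup : NormedAddCommGroup H]
  [innerProductSpace : InnerProductSpace ℂ H]
  [completeSpace : CompleteSpace H]
  π : A →⋆ₙₐ[ℂ] (H →L[ℂ] H)
  nondegenerate : Dense (Submodule.span ℂ {x : H | ∃ a h, π a h = x} : Set H)
  T : H →L[ℂ] H

attribute [instance] OpRep.normedAddCommGroup OpRep.innerProductSpace OpRep.completeSpace

namespace OpRep

variable {A : Type u} [NonUnitalCStarAlgebra A]

/-- `C⋆(π(A) ∪ {T})`. -/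
noncomputable def full (R : OpRep.{u, v} A) : NonUnitalStarSubalgebra ℂ (R.H →L[ℂ] R.H) :=
  cstarGen (Set.range R.π ∪ {R.T})

instance (R : OpRep.{u, v} A) : IsClosed (R.full : Set (R.H →L[ℂ] R.H)) := isClosed_cstarGen _

/-- `π(a)` as an element of `C⋆(π(A) ∪ {T})`. -/
noncomputable def fullπ (R : OpRep.{u, v} A) (a : A) : R.full :=
  ⟨R.π a, subset_cstarGen _ (Or.inl ⟨a, rfl⟩)⟩

/-- `T` as an element of `C⋆(π(A) ∪ {T})`. -/
noncomputable def fullT (R : OpRep.{u, v} A) : R.full :=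
  ⟨R.T, subset_cstarGen _ (Or.inr rfl)⟩

/-- The preorder `R ≾ W`: the assignments `W.π a ↦ R.π a`, `W.T ↦ R.T` extend to a homomorphism
from `C⋆(W.π(A) ∪ {W.T})` (necessarily onto `C⋆(R.π(A) ∪ {R.T})`). -/
def Below (R W : OpRep.{u, v} A) : Prop :=
  ∃ f : W.full →⋆ₙₐ[ℂ] R.full, (∀ a, f (W.fullπ a) = R.fullπ a) ∧ f W.fullT = R.fullT

/-- `W` is universal for the class `P` of pairs: it belongs to `P` and is an upper bound of `P`. -/
def IsUniversal (P : OpRep.{u, v} A → Prop) (W : OpRep.{u, v} A) : Prop :=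
  P W ∧ ∀ R, P R → R.Below W

/-- The `C⋆`-algebra `C⋆(π(A) ∪ π(A)T)`. -/
noncomputable def cstar (R : OpRep.{u, v} A) : NonUnitalStarSubalgebra ℂ (R.H →L[ℂ] R.H) :=
  cstarGen (Set.range R.π ∪ {x | ∃ a, R.π a * R.T = x})

instance (R : OpRep.{u, v} A) : IsClosed (R.cstar : Set (R.H →L[ℂ] R.H)) := isClosed_cstarGen _

/-- `π(a)` as an element of `C⋆(π(A) ∪ π(A)T)`. -/
noncomputable def cstarπ (R : OpRep.{u, v} A) (a : A) : R.cstar :=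
  ⟨R.π a, subset_cstarGen _ (Or.inl ⟨a, rfl⟩)⟩

/-- `π(a)T` as an element of `C⋆(π(A) ∪ π(A)T)`. -/
noncomputable def cstarπT (R : OpRep.{u, v} A) (a : A) : R.cstar :=
  ⟨R.π a * R.T, subset_cstarGen _ (Or.inr ⟨a, rfl⟩)⟩

section DirectSum

variable {I : Type v} {H : I → Type v} [∀ i, NormedAddCommGroup (H i)]
  [∀ i, InnerProductSpace ℂ (H i)] [∀ i, CompleteSpace (H i)]

/-- The direct sum of a family of representations. -/
noncomputable def sumHom (π : ∀ i, A →⋆ₙₐ[ℂ] (H i →L[ℂ] H i)) :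
    A →⋆ₙₐ[ℂ] (lp H 2 →L[ℂ] lp H 2) where
  toFun a := lp.mapCLM 2 (fun i => π i a) (norm_nonneg a)
    (fun i => NonUnitalStarAlgHom.norm_apply_le (π i) a)
  map_smul' c a := by ext x i; simp
  map_zero' := by ext x i; simp
  map_add' a b := by ext x i; simp
  map_mul' a b := by ext x i; simp
  map_star' a := by
    rw [ContinuousLinearMap.star_eq_adjoint, ContinuousLinearMap.eq_adjoint_iff]
    intro x y
    rw [lp.inner_eq_tsum, lp.inner_eq_tsum]
    congr 1
    ext i
    simp [map_star, ContinuousLinearMap.star_eq_adjoint, ContinuousLinearMap.adjoint_inner_left]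

theorem sumHom_apply (π : ∀ i, A →⋆ₙₐ[ℂ] (H i →L[ℂ] H i)) (a : A) (x : lp H 2) (i : I) :
    sumHom π a x i = π i a (x i) := rfl

theorem sumHom_nondegenerate (π : ∀ i, A →⋆ₙₐ[ℂ] (H i →L[ℂ] H i))
    (hπ : ∀ i, Dense (Submodule.span ℂ {x : H i | ∃ a h, π i a h = x} : Set (H i))) :
    Dense (Submodule.span ℂ {x : lp H 2 | ∃ a h, sumHom π a h = x} : Set (lp H 2)) := by
  classical
  set M : Submodule ℂ (lp H 2) := Submodule.span ℂ {x : lp H 2 | ∃ a h, sumHom π a h = x} with hM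
  have h0 : ∀ i, Submodule.span ℂ {x : H i | ∃ a h, π i a h = x} ≤
      M.comap (lp.singleContinuousLinearMap ℂ H 2 i : H i →ₗ[ℂ] lp H 2) := by
    intro i
    rw [Submodule.span_le]
    rintro _ ⟨a, k, rfl⟩
    refine Submodule.subset_span ⟨a, lp.single 2 i k, ?_⟩
    ext j
    rw [sumHom_apply]
    by_cases hj : j = i
    · subst hj; simp
    · simp [hj]
  have h1 : ∀ (i : I) (h : H i), lp.single 2 i h ∈ M.topologicalClosure := fun i h =>
    map_mem_closure (lp.singleContinuousLinearMap ℂ H 2 i).continuous (hπ i h)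
      fun x hx => h0 i hx
  intro f
  refine M.isClosed_topologicalClosure.mem_of_tendsto
    (lp.hasSum_single (E := H) (p := 2) (by norm_num) f) (Eventually.of_forall fun s => ?_)
  exact Submodule.sum_mem _ fun i _ => h1 i _

theorem star_mapCLM (T : ∀ i, H i →L[ℂ] H i) {K : ℝ} (hK : 0 ≤ K) (hT : ∀ i, ‖T i‖ ≤ K)
    (x : lp H 2) (i : I) : (star (lp.mapCLM 2 T hK hT)) x i = (star (T i)) (x i) := by
  have h : star (lp.mapCLM 2 T hK hT) = lp.mapCLM 2 (fun i => star (T i)) hK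
      (fun i => by rw [norm_star]; exact hT i) := by
    rw [eq_comm, ContinuousLinearMap.star_eq_adjoint, ContinuousLinearMap.eq_adjoint_iff]
    intro x y
    rw [lp.inner_eq_tsum, lp.inner_eq_tsum]
    congr 1
    ext i
    simp [ContinuousLinearMap.star_eq_adjoint, ContinuousLinearMap.adjoint_inner_left]
  rw [h]
  rfl

theorem norm_le_of_coord (i : I) (Y : H i →L[ℂ] H i) (X : lp H 2 →L[ℂ] lp H 2)
    (h : ∀ x : lp H 2, X x i = Y (x i)) : ‖Y‖ ≤ ‖X‖ := by
  classical
  refine ContinuousLinearMap.opNorm_le_bound _ (norm_nonneg _) fun k => ?_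
  have h2 := h (lp.single 2 i k)
  rw [lp.single_apply_self] at h2
  rw [← h2, ← lp.norm_single (E := H) (p := 2) (by norm_num) i k]
  exact (lp.norm_apply_le_norm (by norm_num) _ i).trans (ContinuousLinearMap.le_opNorm X _)

end DirectSum

/-- The direct sum of a uniformly bounded family of pairs. -/
noncomputable def directSum {I : Type v} (R : I → OpRep.{u, v} A) (C : ℝ) (hC0 : 0 ≤ C)
    (hC : ∀ i, ‖(R i).T‖ ≤ C) : OpRep.{u, v} A where
  H := lp (fun i => (R i).H) 2
  π := sumHom fun i => (R i).π
  nondegenerate := sumHom_nondegenerate _ fun i => (R i).nondegenerate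
  T := lp.mapCLM 2 (fun i => (R i).T) hC0 hC

theorem below_of_norm_le {R W : OpRep.{u, v} A}
    (h : ∀ d ∈ NonUnitalStarAlgebra.adjoin ℂ
      ({x | (∃ a, (W.π a, R.π a) = x) ∨ (W.T, R.T) = x} :
        Set ((W.H →L[ℂ] W.H) × (R.H →L[ℂ] R.H))), ‖d.2‖ ≤ ‖d.1‖) : R.Below W := by
  set G : Set ((W.H →L[ℂ] W.H) × (R.H →L[ℂ] R.H)) :=
    {x | (∃ a, (W.π a, R.π a) = x) ∨ (W.T, R.T) = x} with hG
  set D := NonUnitalStarAlgebra.adjoin ℂ G with hD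
  let p1 : ((W.H →L[ℂ] W.H) × (R.H →L[ℂ] R.H)) →⋆ₙₐ[ℂ] (W.H →L[ℂ] W.H) :=
    NonUnitalStarAlgHom.fst ℂ _ _
  let p2 : ((W.H →L[ℂ] W.H) × (R.H →L[ℂ] R.H)) →⋆ₙₐ[ℂ] (R.H →L[ℂ] R.H) :=
    NonUnitalStarAlgHom.snd ℂ _ _
  have i1 : p1 '' G = Set.range W.π ∪ {W.T} := by
    ext x; constructor
    · rintro ⟨_, (⟨a, rfl⟩ | rfl), rfl⟩
      · exact Or.inl ⟨a, rfl⟩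
      · exact Or.inr rfl
    · rintro (⟨a, rfl⟩ | rfl)
      · exact ⟨_, Or.inl ⟨a, rfl⟩, rfl⟩
      · exact ⟨_, Or.inr rfl, rfl⟩
  have i2 : p2 '' G = Set.range R.π ∪ {R.T} := by
    ext x; constructor
    · rintro ⟨_, (⟨a, rfl⟩ | rfl), rfl⟩
      · exact Or.inl ⟨a, rfl⟩
      · exact Or.inr rfl
    · rintro (⟨a, rfl⟩ | rfl)
      · exact ⟨_, Or.inl ⟨a, rfl⟩, rfl⟩
      · exact ⟨_, Or.inr rfl, rfl⟩
  have m1 : NonUnitalStarSubalgebra.map p1 D =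
      NonUnitalStarAlgebra.adjoin ℂ (Set.range W.π ∪ {W.T}) := by
    rw [hD, NonUnitalStarAlgHom.map_adjoin, i1]
  have m2 : NonUnitalStarSubalgebra.map p2 D =
      NonUnitalStarAlgebra.adjoin ℂ (Set.range R.π ∪ {R.T}) := by
    rw [hD, NonUnitalStarAlgHom.map_adjoin, i2]
  have e1 : ∀ d ∈ D, d.1 ∈ NonUnitalStarAlgebra.adjoin ℂ (Set.range W.π ∪ {W.T}) := by
    intro d hd; rw [← m1]; exact ⟨d, hd, rfl⟩
  have e2 : ∀ d ∈ D, d.2 ∈ NonUnitalStarAlgebra.adjoin ℂ (Set.range R.π ∪ {R.T}) := by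
    intro d hd; rw [← m2]; exact ⟨d, hd, rfl⟩
  let e : D →ₗ[ℂ] W.full :=
    { toFun := fun d => ⟨d.1.1, subset_closure (e1 d.1 d.2)⟩
      map_add' := fun _ _ => rfl
      map_smul' := fun _ _ => rfl }
  let f : D →ₗ[ℂ] R.full :=
    { toFun := fun d => ⟨d.1.2, subset_closure (e2 d.1 d.2)⟩
      map_add' := fun _ _ => rfl
      map_smul' := fun _ _ => rfl }
  have hdense : DenseRange e := by
    intro x
    rw [closure_subtype]
    have hx : (x : W.H →L[ℂ] W.H) ∈ closure
        (NonUnitalStarAlgebra.adjoin ℂ (Set.range W.π ∪ {W.T}) : Set (W.H →L[ℂ] W.H)) := x.2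
    refine closure_mono ?_ hx
    rw [← m1]
    rintro _ ⟨d, hd, rfl⟩
    exact ⟨e ⟨d, hd⟩, ⟨_, rfl⟩, rfl⟩
  have hbd : ∃ C, ∀ x, ‖f x‖ ≤ C * ‖e x‖ := ⟨1, fun x => by rw [one_mul]; exact h x.1 x.2⟩
  set Φ := f.extendOfNorm e with hΦ
  have hΦe : ∀ d, Φ (e d) = f d := LinearMap.extendOfNorm_eq hdense hbd
  refine ⟨{ toFun := Φ
            map_smul' := fun c x => map_smul Φ c x
            map_zero' := map_zero Φ
            map_add' := map_add Φ
            map_mul' := ?_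
            map_star' := ?_ }, ?_, ?_⟩
  · intro x y
    change Φ (x * y) = Φ x * Φ y
    induction x, y using hdense.induction_on₂ with
    | hp => exact isClosed_eq (by fun_prop) (by fun_prop)
    | h a b =>
      rw [hΦe, hΦe]
      exact hΦe (a * b)
  · intro x
    change Φ (star x) = star (Φ x)
    induction x using hdense.induction_on with
    | hp => exact isClosed_eq (by fun_prop) (by fun_prop)
    | ih a =>
      rw [hΦe]
      exact hΦe (star a)
  · intro a
    exact hΦe ⟨(W.π a, R.π a), NonUnitalStarAlgebra.subset_adjoin ℂ _ (Or.inl ⟨a, rfl⟩)⟩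
  · exact hΦe ⟨(W.T, R.T), NonUnitalStarAlgebra.subset_adjoin ℂ _ (Or.inr rfl)⟩

/-- Evaluation of non-commutative polynomials in the elements of `A`, `T` and `T⋆` at a pair. -/
noncomputable def evalWord (R : OpRep.{u, v} A) :
    FreeNonUnitalNonAssocAlgebra ℂ (A ⊕ Bool) →ₙₐ[ℂ] (R.H →L[ℂ] R.H) :=
  FreeNonUnitalNonAssocAlgebra.lift ℂ
    (Sum.elim (fun a => R.π a) (fun b => if b then R.T else star R.T))

theorem exists_evalWord {R W : OpRep.{u, v} A} {d : (W.H →L[ℂ] W.H) × (R.H →L[ℂ] R.H)}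
    (hd : d ∈ NonUnitalStarAlgebra.adjoin ℂ
      ({x | (∃ a, (W.π a, R.π a) = x) ∨ (W.T, R.T) = x} :
        Set ((W.H →L[ℂ] W.H) × (R.H →L[ℂ] R.H)))) :
    ∃ w, d = (W.evalWord w, R.evalWord w) := by
  change d ∈ NonUnitalAlgebra.adjoin ℂ _ at hd
  induction hd using NonUnitalAlgebra.adjoin_induction with
  | mem x hx =>
    rcases hx with (⟨a, rfl⟩ | rfl) | (⟨a, ha⟩ | ha)
    · exact ⟨FreeNonUnitalNonAssocAlgebra.of ℂ (Sum.inl a), by simp [evalWord]⟩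
    · exact ⟨FreeNonUnitalNonAssocAlgebra.of ℂ (Sum.inr true), by simp [evalWord]⟩
    · refine ⟨FreeNonUnitalNonAssocAlgebra.of ℂ (Sum.inl (star a)), ?_⟩
      rw [← star_star x, ← ha, Prod.star_def]
      simp [evalWord, map_star]
    · refine ⟨FreeNonUnitalNonAssocAlgebra.of ℂ (Sum.inr false), ?_⟩
      rw [← star_star x, ← ha, Prod.star_def]
      simp [evalWord]
  | add x y _ _ hx hy =>
    obtain ⟨a, rfl⟩ := hx
    obtain ⟨b, rfl⟩ := hy
    exact ⟨a + b, by simp⟩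
  | zero => exact ⟨0, by rw [map_zero, map_zero]; rfl⟩
  | mul x y _ _ hx hy =>
    obtain ⟨a, rfl⟩ := hx
    obtain ⟨b, rfl⟩ := hy
    exact ⟨a * b, by simp⟩
  | smul r x _ hx =>
    obtain ⟨a, rfl⟩ := hx
    exact ⟨r • a, by simp⟩

/-- The coordinates of a vector of a direct sum. -/
def coord {I : Type v} (R : I → OpRep.{u, v} A) (x : lp (fun i => (R i).H) 2) (i : I) :
    (R i).H := x i

theorem evalWord_directSum {I : Type v} (R : I → OpRep.{u, v} A) (C : ℝ) (hC0 : 0 ≤ C)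
    (hC : ∀ i, ‖(R i).T‖ ≤ C) (w : FreeNonUnitalNonAssocAlgebra ℂ (A ⊕ Bool))
    (x : lp (fun i => (R i).H) 2) (i : I) :
    coord R ((directSum R C hC0 hC).evalWord w x) i = (R i).evalWord w (coord R x i) := by
  set W := directSum R C hC0 hC with hW
  let S : NonUnitalSubalgebra ℂ ((W.H →L[ℂ] W.H) × ((R i).H →L[ℂ] (R i).H)) :=
    { carrier := {d | ∀ x : lp (fun i => (R i).H) 2,
        coord R (d.1 x) i = d.2 (coord R x i)}
      add_mem' := fun {a b} ha hb x => by
        change coord R (a.1 x) i + coord R (b.1 x) i = _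
        rw [ha, hb]
        rfl
      zero_mem' := fun x => rfl
      mul_mem' := fun {a b} ha hb x => by
        change coord R (a.1 (b.1 x)) i = a.2 (b.2 (coord R x i))
        rw [← hb x]
        exact ha _
      smul_mem' := fun c a ha x => by
        change c • coord R (a.1 x) i = c • a.2 (coord R x i)
        rw [ha] }
  have hgen : ∀ g : A ⊕ Bool,
      ((Sum.elim (fun a => W.π a) (fun b => if b then W.T else star W.T) g,
        Sum.elim (fun a => (R i).π a) (fun b => if b then (R i).T else star (R i).T) g) :
        (W.H →L[ℂ] W.H) × ((R i).H →L[ℂ] (R i).H)) ∈ S := by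
    rintro (a | b) x
    · rfl
    · cases b
      · exact star_mapCLM (fun i => (R i).T) hC0 hC x i
      · rfl
  let φ : FreeNonUnitalNonAssocAlgebra ℂ (A ⊕ Bool) →ₙₐ[ℂ] S :=
    FreeNonUnitalNonAssocAlgebra.lift ℂ fun g => ⟨_, hgen g⟩
  have h1 : ((NonUnitalAlgHom.fst ℂ _ _).comp (NonUnitalSubalgebraClass.subtype S)).comp φ
      = W.evalWord := by
    refine FreeNonUnitalNonAssocAlgebra.hom_ext ℂ fun g => ?_
    simp [φ, evalWord]
  have h2 : ((NonUnitalAlgHom.snd ℂ _ _).comp (NonUnitalSubalgebraClass.subtype S)).comp φ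
      = (R i).evalWord := by
    refine FreeNonUnitalNonAssocAlgebra.hom_ext ℂ fun g => ?_
    simp [φ, evalWord]
  rw [← h1, ← h2]
  exact (φ w).2 x

theorem norm_evalWord_le_directSum {I : Type v} (R : I → OpRep.{u, v} A) (C : ℝ) (hC0 : 0 ≤ C)
    (hC : ∀ i, ‖(R i).T‖ ≤ C) (w : FreeNonUnitalNonAssocAlgebra ℂ (A ⊕ Bool)) (i : I) :
    ‖(R i).evalWord w‖ ≤ ‖(directSum R C hC0 hC).evalWord w‖ := by
  exact norm_le_of_coord (H := fun i => (R i).H) i ((R i).evalWord w)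
    ((directSum R C hC0 hC).evalWord w) fun x => evalWord_directSum R C hC0 hC w x i

/-- A class of uniformly bounded pairs that is closed under direct sums has a universal pair. -/
theorem exists_isUniversal {P : OpRep.{u, u} A → Prop} (C : ℝ) (hC0 : 0 ≤ C)
    (hC : ∀ R, P R → ‖R.T‖ ≤ C)
    (hP : ∀ (I : Type u) (R : I → OpRep.{u, u} A) (h : ∀ i, P (R i)),
      P (directSum R C hC0 fun i => hC _ (h i))) :
    ∃ W, IsUniversal P W := by
  let I : Type u := {p : FreeNonUnitalNonAssocAlgebra ℂ (A ⊕ Bool) → ℝ //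
    ∃ R : OpRep.{u, u} A, P R ∧ ∀ w, ‖R.evalWord w‖ = p w}
  choose S hS hSn using fun i : I => i.2
  refine ⟨directSum S C hC0 fun i => hC _ (hS i), hP I S hS, fun R hR => ?_⟩
  refine below_of_norm_le fun d hd => ?_
  obtain ⟨w, rfl⟩ := exists_evalWord hd
  have h1 := norm_evalWord_le_directSum S C hC0 (fun i => hC _ (hS i)) w
    ⟨fun w => ‖R.evalWord w‖, R, hR, fun _ => rfl⟩
  rw [hSn] at h1
  exact h1

end OpRep

/-! ### Representations of an endomorphism and their universal pairs -/

namespace OpRep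

variable {A : Type u} [NonUnitalCStarAlgebra A]

/-- `(π, S)` is a representation of `(A, α)`: `S⋆ π(a) S = π(α(a))`. -/
def IsRep (α : A →⋆ₙₐ[ℂ] A) (R : OpRep.{u, v} A) : Prop :=
  ∀ a, star R.T * R.π a * R.T = R.π (α a)

/-- `(π, S)` is a representation of `(A, α)` with `J ⊆ {a : S S⋆ π(a) = π(a)}`. -/
def IsRepFixing (α : A →⋆ₙₐ[ℂ] A) (J : Set A) (R : OpRep.{u, v} A) : Prop :=
  R.IsRep α ∧ J ⊆ {a | R.T * star R.T * R.π a = R.π a}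

/-- `(π, U)` is a representation of the endomorphism `α`: `U π(a) U⋆ = π(α(a))`. -/
def IsEndoRep (α : A →⋆ₙₐ[ℂ] A) (R : OpRep.{u, v} A) : Prop :=
  ∀ a, R.T * R.π a * star R.T = R.π (α a)

/-- `(π, U)` is a `J`-covariant representation of the endomorphism `α`:
`J ⊆ {a : U⋆ U π(a) = π(a)}`. -/
def IsEndoCovariant (α : A →⋆ₙₐ[ℂ] A) (J : Set A) (R : OpRep.{u, v} A) : Prop :=
  R.IsEndoRep α ∧ J ⊆ {a | star R.T * R.T * R.π a = R.π a}

/-- `(π, U)` is an isometric representation of the endomorphism `α`. -/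
def IsIsometric (α : A →⋆ₙₐ[ℂ] A) (R : OpRep.{u, v} A) : Prop :=
  R.IsEndoRep α ∧ star R.T * R.T = 1

/-- `(π, U)` is a partial-isometric representation of the endomorphism `α`: `U` is a partial
isometry and `U⋆ U` commutes with `π(A)`. -/
def IsPartialIsometric (α : A →⋆ₙₐ[ℂ] A) (R : OpRep.{u, v} A) : Prop :=
  R.IsEndoRep α ∧ R.T * star R.T * R.T = R.T ∧ ∀ a, star R.T * R.T * R.π a = R.π a * (star R.T * R.T)

theorem tendsto_π (R : OpRep.{u, v} A) {l : Filter A}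
    (hr : ∀ m : A, Tendsto (fun e => e * m) l (𝓝 m)) (hn : ∀ᶠ e in l, ‖e‖ ≤ 1) (k : R.H) :
    Tendsto (fun e => R.π e k) l (𝓝 k) := by
  have h1 : ∀ m ∈ Submodule.span ℂ {x : R.H | ∃ a h, R.π a h = x},
      Tendsto (fun e => R.π e m) l (𝓝 m) := by
    intro m hm
    induction hm using Submodule.span_induction with
    | mem x hx =>
      obtain ⟨a, h, rfl⟩ := hx
      have hc : Continuous fun b : A => R.π b h :=
        (ContinuousLinearMap.apply ℂ R.H h).continuous.comp
          (AddMonoidHomClass.continuous_of_bound R.π 1 fun b => by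
            rw [one_mul]; exact NonUnitalStarAlgHom.norm_apply_le R.π b)
      have := (hc.tendsto a).comp (hr a)
      refine this.congr fun e => ?_
      simp
    | zero => simpa using tendsto_const_nhds
    | add x y _ _ hx hy => simpa using hx.add hy
    | smul c x _ hx => simpa using hx.const_smul c
  rw [Metric.tendsto_nhds]
  intro ε hε
  obtain ⟨m, hm, hkm⟩ := Metric.mem_closure_iff.mp (R.nondegenerate k) (ε / 3) (by positivity)
  filter_upwards [hn, Metric.tendsto_nhds.mp (h1 m hm) (ε / 3) (by positivity)] with e h2 h3
  have h4 : dist (R.π e k) (R.π e m) ≤ dist k m := by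
    rw [dist_eq_norm, dist_eq_norm, ← map_sub]
    refine ((R.π e).le_opNorm _).trans (mul_le_of_le_one_left (norm_nonneg _) ?_)
    exact (NonUnitalStarAlgHom.norm_apply_le R.π e).trans h2
  have h5 := dist_triangle4 (R.π e k) (R.π e m) m k
  rw [dist_comm m k] at h5
  linarith

theorem norm_le_one_of_rel (R : OpRep.{u, v} A) (α : A →⋆ₙₐ[ℂ] A) (S : R.H →L[ℂ] R.H)
    (h : ∀ a, star S * R.π a * S = R.π (α a)) : ‖S‖ ≤ 1 := by
  obtain ⟨l, hl, -, hr, he⟩ := CStarAux.exists_approx A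
  have hn : ∀ᶠ e in l, ‖e‖ ≤ 1 := he.mono fun e h => h.2.1
  refine ContinuousLinearMap.opNorm_le_bound _ zero_le_one fun k => ?_
  refine le_of_tendsto (R.tendsto_π hr hn (S k)).norm ?_
  filter_upwards [hn] with e h1
  have h2 : ‖R.π e * S‖ * ‖R.π e * S‖ ≤ 1 := by
    rw [← CStarRing.norm_star_mul_self, star_mul, ← map_star, mul_assoc, ← mul_assoc (R.π (star e)),
      ← map_mul, ← mul_assoc, h]
    refine (NonUnitalStarAlgHom.norm_apply_le R.π _).trans
      ((NonUnitalStarAlgHom.norm_apply_le α _).trans ?_)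
    rw [CStarRing.norm_star_mul_self]
    exact mul_le_one₀ h1 (norm_nonneg _) h1
  have h3 : ‖R.π e * S‖ ≤ 1 := by nlinarith [norm_nonneg (R.π e * S)]
  exact ((R.π e * S).le_opNorm k).trans (mul_le_mul_of_nonneg_right h3 (norm_nonneg _))

theorem IsRep.norm_le {α : A →⋆ₙₐ[ℂ] A} {R : OpRep.{u, v} A} (h : R.IsRep α) : ‖R.T‖ ≤ 1 :=
  R.norm_le_one_of_rel α _ h

theorem IsEndoRep.norm_le {α : A →⋆ₙₐ[ℂ] A} {R : OpRep.{u, v} A} (h : R.IsEndoRep α) :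
    ‖R.T‖ ≤ 1 := by
  rw [← norm_star]
  exact R.norm_le_one_of_rel α _ fun a => by rw [star_star]; exact h a

section DirectSum

variable {I : Type v} (R : I → OpRep.{u, v} A) (C : ℝ) (hC0 : 0 ≤ C) (hC : ∀ i, ‖(R i).T‖ ≤ C)

theorem directSum_ext {X Y : (directSum R C hC0 hC).H →L[ℂ] (directSum R C hC0 hC).H}
    (h : ∀ x i, coord R (X x) i = coord R (Y x) i) : X = Y :=
  ContinuousLinearMap.ext fun x => lp.ext (funext fun i => h x i)

theorem coord_T (x : (directSum R C hC0 hC).H) (i : I) :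
    coord R ((directSum R C hC0 hC).T x) i = (R i).T (coord R x i) := rfl

theorem coord_star_T (x : (directSum R C hC0 hC).H) (i : I) :
    coord R ((star (directSum R C hC0 hC).T) x) i = (star (R i).T) (coord R x i) :=
  star_mapCLM (fun i => (R i).T) hC0 hC x i

theorem coord_π (a : A) (x : (directSum R C hC0 hC).H) (i : I) :
    coord R ((directSum R C hC0 hC).π a x) i = (R i).π a (coord R x i) := rfl

theorem isRep_directSum (α : A →⋆ₙₐ[ℂ] A) (h : ∀ i, (R i).IsRep α) :
    (directSum R C hC0 hC).IsRep α := fun a => directSum_ext R C hC0 hC fun x i => by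
  rw [coord_π, ← h i a]
  simp only [mul_apply_eq_comp, coord_star_T, coord_T, coord_π]

theorem isEndoRep_directSum (α : A →⋆ₙₐ[ℂ] A) (h : ∀ i, (R i).IsEndoRep α) :
    (directSum R C hC0 hC).IsEndoRep α := fun a => directSum_ext R C hC0 hC fun x i => by
  rw [coord_π, ← h i a]
  simp only [mul_apply_eq_comp, coord_star_T, coord_T, coord_π]

end DirectSum

theorem exists_isUniversal_isRep (α : A →⋆ₙₐ[ℂ] A) :
    ∃ W : OpRep.{u, u} A, IsUniversal (IsRep α) W :=
  exists_isUniversal 1 zero_le_one (fun _ h => h.norm_le)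
    fun _ R h => isRep_directSum R _ _ _ α h

theorem exists_isUniversal_isEndoCovariant (α : A →⋆ₙₐ[ℂ] A) (J : Set A) :
    ∃ W : OpRep.{u, u} A, IsUniversal (IsEndoCovariant α J) W :=
  exists_isUniversal 1 zero_le_one (fun _ h => h.1.norm_le) fun _ R h =>
    ⟨isEndoRep_directSum R _ _ _ α fun i => (h i).1, fun a ha =>
      directSum_ext R _ _ _ fun x i => by
        rw [coord_π, ← (h i).2 ha]
        simp only [mul_apply_eq_comp, coord_star_T, coord_T, coord_π]⟩

theorem exists_isUniversal_isIsometric (α : A →⋆ₙₐ[ℂ] A) :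
    ∃ W : OpRep.{u, u} A, IsUniversal (IsIsometric α) W :=
  exists_isUniversal 1 zero_le_one (fun _ h => h.1.norm_le) fun _ R h =>
    ⟨isEndoRep_directSum R _ _ _ α fun i => (h i).1,
      directSum_ext R _ _ _ fun x i => by
        have := DFunLike.congr_fun (h i).2 (coord R x i)
        simp only [mul_apply_eq_comp, coord_star_T, coord_T] at this ⊢
        exact this⟩

theorem exists_isUniversal_isPartialIsometric (α : A →⋆ₙₐ[ℂ] A) :
    ∃ W : OpRep.{u, u} A, IsUniversal (IsPartialIsometric α) W :=
  exists_isUniversal 1 zero_le_one (fun _ h => h.1.norm_le) fun _ R h =>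
    ⟨isEndoRep_directSum R _ _ _ α fun i => (h i).1,
      directSum_ext R _ _ _ fun x i => by
        have := DFunLike.congr_fun (h i).2.1 (coord R x i)
        simp only [mul_apply_eq_comp, coord_star_T, coord_T] at this ⊢
        exact this,
      fun a => directSum_ext R _ _ _ fun x i => by
        have := DFunLike.congr_fun ((h i).2.2 a) (coord R x i)
        simp only [mul_apply_eq_comp, coord_star_T, coord_T, coord_π] at this ⊢
        exact this⟩

/-! ### Redundancies and ideals of covariance -/

/-- The closed linear span of `π(A) S π(A) S⋆ π(A)`. -/
noncomputable def middle (R : OpRep.{u, v} A) : Submodule ℂ (R.H →L[ℂ] R.H) :=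
  (Submodule.span ℂ
    {x | ∃ a b c, R.π a * R.T * R.π b * star R.T * R.π c = x}).topologicalClosure

/-- `(π(a), k)` is a redundancy of `(π, S)`. -/
def IsRedundancy (R : OpRep.{u, v} A) (a : A) (k : R.H →L[ℂ] R.H) : Prop :=
  k ∈ R.middle ∧ ∀ b, R.π a * R.π b * R.T = k * R.π b * R.T

/-- The ideal of covariance `J_{(π, S)}`: all `a` such that `(π(a), π(a))` is a redundancy. -/
def covIdeal (R : OpRep.{u, v} A) : Set A := {a | R.IsRedundancy a (R.π a)}

end OpRep

/-! ### The `C⋆`-correspondence of `(A, α)` -/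

section GNS

open scoped TensorProduct

variable {A : Type u} [NonUnitalCStarAlgebra A]

/-- The algebraic tensor product `A ⊙ A`, to be seminormed by the form
`⟨a ⊙ b, c ⊙ d⟩ = b⋆ α(a⋆ c) d`. -/
def GNSPre (_α : A →⋆ₙₐ[ℂ] A) : Type u := A ⊗[ℂ] A

namespace GNSPre

variable (α : A →⋆ₙₐ[ℂ] A)

noncomputable instance : AddCommGroup (GNSPre α) := inferInstanceAs (AddCommGroup (A ⊗[ℂ] A))

noncomputable instance : Module ℂ (GNSPre α) := inferInstanceAs (Module ℂ (A ⊗[ℂ] A))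

/-- The simple tensor `a ⊙ b`. -/
noncomputable def tmul (a b : A) : GNSPre α := (a ⊗ₜ[ℂ] b : A ⊗[ℂ] A)

/-- The linear map `a ⊙ b ↦ α(a) b`. -/
noncomputable def toA : GNSPre α →ₗ[ℂ] A :=
  (LinearMap.mul' ℂ A).comp (TensorProduct.map (α : A →ₗ[ℂ] A) LinearMap.id)

theorem toA_tmul (a b : A) : toA α (tmul α a b) = α a * b := rfl

/-- The `A`-valued sesquilinear form determined by `⟨a ⊙ b, c ⊙ d⟩ = b⋆ α(a⋆ c) d`. -/
noncomputable def form (x y : GNSPre α) : A := star (toA α x) * toA α y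

theorem form_tmul (a b c d : A) :
    form α (tmul α a b) (tmul α c d) = star b * α (star a * c) * d := by
  simp only [form, toA_tmul, star_mul, map_mul, map_star, mul_assoc]

/-- The seminorm `‖x‖ = ‖⟨x, x⟩‖ ^ (1 / 2)`; see `norm_eq`. -/
noncomputable instance : SeminormedAddCommGroup (GNSPre α) :=
  SeminormedAddCommGroup.induced _ _ (toA α)

noncomputable instance : NormedSpace ℂ (GNSPre α) := NormedSpace.induced ℂ _ _ (toA α)

theorem norm_def (x : GNSPre α) : ‖x‖ = ‖toA α x‖ := rfl

theorem norm_eq (x : GNSPre α) : ‖x‖ = √‖form α x x‖ := by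
  rw [norm_def, form, CStarRing.norm_star_mul_self, Real.sqrt_mul_self (norm_nonneg _)]

/-- The left action `a · (b ⊙ c) = (a b) ⊙ c`. -/
noncomputable def left (a : A) : GNSPre α →ₗ[ℂ] GNSPre α :=
  LinearMap.rTensor A (LinearMap.mulLeft ℂ a)

/-- The right action `(b ⊙ c) · a = b ⊙ (c a)`. -/
noncomputable def right (a : A) : GNSPre α →ₗ[ℂ] GNSPre α :=
  LinearMap.lTensor A (LinearMap.mulRight ℂ a)

theorem left_tmul (a b c : A) : left α a (tmul α b c) = tmul α (a * b) c := rfl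

theorem right_tmul (a b c : A) : right α a (tmul α b c) = tmul α b (c * a) := rfl

theorem toA_left (a : A) (x : GNSPre α) : toA α (left α a x) = α a * toA α x := by
  refine TensorProduct.induction_on (motive := fun x : GNSPre α =>
    toA α (left α a x) = α a * toA α x) x ?_ (fun b c => ?_) fun x y hx hy => ?_
  · exact (map_zero ((toA α).comp (left α a))).trans (by
      rw [show toA α (0 : A ⊗[ℂ] A) = 0 from map_zero (toA α), mul_zero])
  · change α (a * b) * c = α a * (α b * c)
    rw [map_mul, mul_assoc]
  · have h1 : toA α (left α a (x + y)) = toA α (left α a x) + toA α (left α a y) :=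
      map_add ((toA α).comp (left α a)) x y
    have h2 : toA α (x + y) = toA α x + toA α y := map_add (toA α) x y
    exact h1.trans (by rw [hx, hy, ← mul_add, ← h2])

theorem toA_right (a : A) (x : GNSPre α) : toA α (right α a x) = toA α x * a := by
  refine TensorProduct.induction_on (motive := fun x : GNSPre α =>
    toA α (right α a x) = toA α x * a) x ?_ (fun b c => ?_) fun x y hx hy => ?_
  · exact (map_zero ((toA α).comp (right α a))).trans (by
      rw [show toA α (0 : A ⊗[ℂ] A) = 0 from map_zero (toA α), zero_mul])
  · change α b * (c * a) = α b * c * a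
    rw [mul_assoc]
  · have h1 : toA α (right α a (x + y)) = toA α (right α a x) + toA α (right α a y) :=
      map_add ((toA α).comp (right α a)) x y
    have h2 : toA α (x + y) = toA α x + toA α y := map_add (toA α) x y
    exact h1.trans (by rw [hx, hy, ← add_mul, ← h2])

/-- The left action by `a` as a bounded operator. -/
noncomputable def leftL (a : A) : GNSPre α →L[ℂ] GNSPre α :=
  (left α a).mkContinuous ‖a‖ fun x => by
    rw [norm_def, norm_def, toA_left]
    exact (norm_mul_le _ _).trans
      (mul_le_mul_of_nonneg_right (NonUnitalStarAlgHom.norm_apply_le α a) (norm_nonneg _))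

/-- The right action by `a` as a bounded operator. -/
noncomputable def rightL (a : A) : GNSPre α →L[ℂ] GNSPre α :=
  (right α a).mkContinuous ‖a‖ fun x => by
    rw [norm_def, norm_def, toA_right, mul_comm ‖a‖]
    exact norm_mul_le _ _

end GNSPre

/-- The `C⋆`-correspondence `X_α` of `(A, α)`: the Hausdorff completion of `A ⊙ A`. -/
abbrev GNSModule (α : A →⋆ₙₐ[ℂ] A) : Type u := UniformSpace.Completion (GNSPre α)

namespace GNSModule

variable (α : A →⋆ₙₐ[ℂ] A)

/-- The left action `φ : A → 𝓛(X_α)`. -/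
noncomputable def left (a : A) : GNSModule α →L[ℂ] GNSModule α :=
  (GNSPre.leftL α a).completion

/-- The right action of `A` on `X_α`. -/
noncomputable def right (a : A) : GNSModule α →L[ℂ] GNSModule α :=
  (GNSPre.rightL α a).completion

/-- The continuous extension to `X_α` of `a ⊙ b ↦ α(a) b`. -/
noncomputable def toA : GNSModule α → A := UniformSpace.Completion.extension (GNSPre.toA α)

/-- The `A`-valued inner product of `X_α`: the continuous extension of the form on `A ⊙ A`. -/
noncomputable def inner (x y : GNSModule α) : A := star (toA α x) * toA α y

theorem uniformContinuous_toA : UniformContinuous (GNSPre.toA α) :=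
  (AddMonoidHomClass.isometry_of_norm (GNSPre.toA α) fun x =>
    (GNSPre.norm_def α x).symm).uniformContinuous

theorem inner_coe (x y : GNSPre α) : inner α (x : GNSModule α) y = GNSPre.form α x y := by
  simp only [inner, toA, UniformSpace.Completion.extension_coe (uniformContinuous_toA α),
    GNSPre.form]

theorem continuous_inner : Continuous fun p : GNSModule α × GNSModule α => inner α p.1 p.2 :=
  (continuous_star.comp (UniformSpace.Completion.continuous_extension.comp continuous_fst)).mul
    (UniformSpace.Completion.continuous_extension.comp continuous_snd)

/-- The space `𝓚(X_α)` of generalized compact operators: the closed linear span of the operators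
`Θ_{x, y} : z ↦ x · ⟨y, z⟩`. -/
noncomputable def compacts : Submodule ℂ (GNSModule α →L[ℂ] GNSModule α) :=
  (Submodule.span ℂ
    {t | ∃ x y, ∀ z, t z = right α (inner α y z) x}).topologicalClosure

/-- `J(X_α) = φ⁻¹(𝓚(X_α))`. -/
def jIdeal : Set A := {a | left α a ∈ compacts α}

end GNSModule

end GNS

namespace OpRep

variable {A : Type u} [NonUnitalCStarAlgebra A]

/-- A representation `(π, S)` of `(A, α)` is `J`-covariant: `J ∩ J(X_α) ⊆ J_{(π, S)}`. -/
def IsCovariant (α : A →⋆ₙₐ[ℂ] A) (J : Set A) (R : OpRep.{u, v} A) : Prop :=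
  J ∩ GNSModule.jIdeal α ⊆ R.covIdeal

end OpRep

/-! ### Crossed products -/

section CrossedProducts

variable {A : Type u} [NonUnitalCStarAlgebra A]

/-- The annihilator `I^⊥ = {a : a I = 0}`. -/
def annihilatorSet (I : Set A) : Set A := {a | ∀ x ∈ I, a * x = 0}

/-- The GNS-kernel `N_α = {a : α((a b)⋆ (a b)) = 0 for all b}`. -/
def gnsKernel (α : A →⋆ₙₐ[ℂ] A) : Set A := {a | ∀ b, α (star (a * b) * (a * b)) = 0}

/-- The kernel of `α`. -/
def kerSet (α : A →⋆ₙₐ[ℂ] A) : Set A := {a | α a = 0}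

/-- The universal representation `(i_A, t)` of `(A, α)`. -/
noncomputable def toeplitzRep (α : A →⋆ₙₐ[ℂ] A) : OpRep.{u, u} A :=
  (OpRep.exists_isUniversal_isRep α).choose

/-- The Toeplitz algebra `𝒯(A, α) = C⋆(i_A(A) ∪ i_A(A) t)`. -/
abbrev ToeplitzAlgebra (α : A →⋆ₙₐ[ℂ] A) : Type u := (toeplitzRep α).cstar

/-- The differences `i_A(a) - k`, where `a ∈ J` and `(i_A(a), k)` is a redundancy of `(i_A, t)`. -/
def redundancySet (α : A →⋆ₙₐ[ℂ] A) (J : Set A) : Set (ToeplitzAlgebra α) :=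
  {x | ∃ a ∈ J, ∃ k, (toeplitzRep α).IsRedundancy a k ∧
    (x : (toeplitzRep α).H →L[ℂ] (toeplitzRep α).H) = (toeplitzRep α).π a - k}

/-- The closed ideal of the Toeplitz algebra generated by `redundancySet α J`. -/
noncomputable def redundancyIdeal (α : A →⋆ₙₐ[ℂ] A) (J : Set A) :
    ClosedIdeal (ToeplitzAlgebra α) :=
  ClosedIdeal.closedSpan (redundancySet α J)

/-- The relative crossed product `C⋆(A, α; J)`. -/
abbrev CrossedProduct (α : A →⋆ₙₐ[ℂ] A) (J : Set A) : Type u := (redundancyIdeal α J).QuotAlg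

/-- The element `j_A(a)` of `C⋆(A, α; J)`. -/
noncomputable def jA (α : A →⋆ₙₐ[ℂ] A) (J : Set A) (a : A) : CrossedProduct α J :=
  ClosedIdeal.QuotAlg.mk (redundancyIdeal α J) ((toeplitzRep α).cstarπ a)

/-- The element `j_A(a) s` of `C⋆(A, α; J)`: the class of `i_A(a) t`. -/
noncomputable def jAs (α : A →⋆ₙₐ[ℂ] A) (J : Set A) (a : A) : CrossedProduct α J :=
  ClosedIdeal.QuotAlg.mk (redundancyIdeal α J) ((toeplitzRep α).cstarπT a)

/-- The representation `R = (j_A, s)` of `(A, α)` generates `C⋆(A, α; J)` via `Ψ`: the isomorphism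
`Ψ : C⋆(A, α; J) → C⋆(R)` sends the classes of `i_A(a)` and `i_A(a) t` to `R.π a` and `R.π a R.T`. -/
def Generates (α : A →⋆ₙₐ[ℂ] A) (J : Set A) (R : OpRep.{u, v} A)
    (Ψ : CrossedProduct α J ≃⋆ₐ[ℂ] R.cstar) : Prop :=
  R.IsRep α ∧ (∀ a, Ψ (jA α J a) = R.cstarπ a) ∧ ∀ a, Ψ (jAs α J a) = R.cstarπT a

/-- The multiplier `s` of `C⋆(A, α; J)`: the product of `j_A(a)` and `s` is the class
`j_A(a) s` of `i_A(a) t`, for all `a`. -/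
def IsMultiplierS (α : A →⋆ₙₐ[ℂ] A) (J : Set A) (s : 𝓜(ℂ, CrossedProduct α J)) : Prop :=
  ∀ a, (DoubleCentralizer.coe ℂ (jA α J a) : 𝓜(ℂ, CrossedProduct α J)) * s
    = DoubleCentralizer.coe ℂ (jAs α J a)

/-- The universal `J`-covariant representation `(i_A, u)` of the endomorphism `α`. -/
noncomputable def endoRep (α : A →⋆ₙₐ[ℂ] A) (J : Set A) : OpRep.{u, u} A :=
  (OpRep.exists_isUniversal_isEndoCovariant α J).choose

/-- `C⋆_endo(A, α; J) = C⋆(i_A(A) ∪ i_A(A) u)`. -/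
noncomputable def cstarEndo (α : A →⋆ₙₐ[ℂ] A) (J : Set A) :
    NonUnitalStarSubalgebra ℂ ((endoRep α J).H →L[ℂ] (endoRep α J).H) :=
  (endoRep α J).cstar

/-- The universal isometric representation `(i_A, u)` of the endomorphism `α`. -/
noncomputable def staceyRep (α : A →⋆ₙₐ[ℂ] A) : OpRep.{u, u} A :=
  (OpRep.exists_isUniversal_isIsometric α).choose

/-- Stacey's crossed product: `C⋆({i_A(a) uⁿ u⋆ᵐ : a ∈ A, n, m ∈ ℕ})`. -/
noncomputable def staceyProduct (α : A →⋆ₙₐ[ℂ] A) :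
    NonUnitalStarSubalgebra ℂ ((staceyRep α).H →L[ℂ] (staceyRep α).H) :=
  cstarGen {x | ∃ (a : A) (n m : ℕ),
    (staceyRep α).π a * (staceyRep α).T ^ n * star (staceyRep α).T ^ m = x}

/-- The universal partial-isometric representation `(i_A, u)` of the endomorphism `α`. -/
noncomputable def partialIsometricRep (α : A →⋆ₙₐ[ℂ] A) : OpRep.{u, u} A :=
  (OpRep.exists_isUniversal_isPartialIsometric α).choose

/-- The partial-isometric crossed product: `C⋆(i_A(A) ∪ u i_A(A))`. -/
noncomputable def partialIsometricProduct (α : A →⋆ₙₐ[ℂ] A) :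
    NonUnitalStarSubalgebra ℂ ((partialIsometricRep α).H →L[ℂ] (partialIsometricRep α).H) :=
  cstarGen (Set.range (partialIsometricRep α).π ∪
    {x | ∃ a, (partialIsometricRep α).T * (partialIsometricRep α).π a = x})

/-- The assignments `j_A(a) ↦ i_A(a)`, `s j_A(a) ↦ u⋆ i_A(a)` establish an isomorphism from
`C⋆(A, α; J)` onto the algebra `B` of operators on the space of `W = (i_A, u)`. -/
def EstablishIso (α : A →⋆ₙₐ[ℂ] A) (J : Set A) (s : 𝓜(ℂ, CrossedProduct α J))
    (W : OpRep.{u, u} A) (B : NonUnitalStarSubalgebra ℂ (W.H →L[ℂ] W.H)) : Prop :=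
  ∃ Ψ : CrossedProduct α J ≃⋆ₐ[ℂ] B,
    (∀ a, (Ψ (jA α J a) : W.H →L[ℂ] W.H) = W.π a) ∧
    ∀ a, (Ψ (s.fst (jA α J a)) : W.H →L[ℂ] W.H) = star W.T * W.π a

/-- The strict topology on `M(A)`: `m_λ → m` iff `m_λ a → m a` and `a m_λ → a m` in norm for all
`a ∈ A`. -/
noncomputable abbrev strictTopology (A : Type u) [NonUnitalCStarAlgebra A] : TopologicalSpace 𝓜(ℂ, A) :=
  TopologicalSpace.induced
    (fun m => ((fun a => m.fst a, fun a => m.snd a) : (A → A) × (A → A))) inferInstance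

/-- `α` is extendible: it extends to a strictly continuous mapping `M(A) → M(A)`. -/
def IsExtendible (α : A →⋆ₙₐ[ℂ] A) : Prop :=
  ∃ β : 𝓜(ℂ, A) → 𝓜(ℂ, A),
    Continuous[strictTopology A, strictTopology A] β ∧
    ∀ a, β (DoubleCentralizer.coe ℂ a) = DoubleCentralizer.coe ℂ (α a)

end CrossedProducts

/-! For an endomorphism, the relation `S⋆ π(a) S = π(α(a))` already forces `π(a) S = S π(α(a))`:
expanding `(π(a)S - Sπ(α(a)))⋆ (π(a)S - Sπ(α(a)))`, all terms cancel once `S⋆S π(α(a)) = π(α(a))` is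
known, and that identity comes from letting an approximate unit run through `S⋆ π(e) S π(α(a)) =
π(α(ea))`. Hence `S` is a partial isometry, `SS⋆` commutes with `π(A)`, and the only redundancy with
first entry `π(a)` is `π(a)SS⋆` (`isRedundancy_iff`), so `J_{(π,S)} = {a : SS⋆π(a) = π(a)}`.
Moreover `a ⊙ b ↦ α(a)b` embeds `X_α` isometrically in `A`, which exhibits the left action of a
product of four elements as a single `Θ_{x,y}`; hence `J(X_α) = A` (`jIdeal_eq_univ`). The two facts
give part 1.

The ideal divided out is thus generated by the elements `i_A(a) - i_A(a)tt⋆` with `a ∈ J`, and a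
representation of the Toeplitz algebra coming from a pair kills it exactly when the pair satisfies
the fixing condition (`Represents.fixing_iff`). This yields the homomorphisms out of the crossed
product. That a universal fixing pair generates it faithfully requires enough fixing pairs: an
element outside the ideal survives in some GNS representation that kills the ideal
(`exists_separating_rep`), and a nondegenerate representation of the Toeplitz algebra always comes
from a pair, whose operator is recovered as the adjoint of a strong limit
(`IsRep.exists_represents`).

If `α` is extendible, `α(e)b` converges in norm along an approximate unit, so `π(e)Sπ(b) =
Sπ(α(e)b)` converges in norm. This puts `Sπ(b)` into `C⋆(π,S)`, and `S` becomes a multiplier.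
Passing from `(π,S)` to `(π,S⋆)` exchanges representations of `(A,α)` with representations of the
endomorphism. The isometric ones are those fixing all of `A`. Every one is partial-isometric, which
is the case `J = {0}`. The four isomorphisms are therefore one statement, combined with comparisons
of generating sets. -/

theorem NonUnitalStarAlgHom.continuous_of_cstar {B : Type u} {C : Type v} [NonUnitalCStarAlgebra B]
    [NonUnitalCStarAlgebra C] (φ : B →⋆ₙₐ[ℂ] C) : Continuous φ :=
  AddMonoidHomClass.continuous_of_bound φ 1 fun b => by
    rw [one_mul]; exact NonUnitalStarAlgHom.norm_apply_le φ b

/-- The error `(f e - a) e` is controlled by `‖e‖ ≤ 1`. Iterating lets the same index `e` be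
inserted in several places of a product. -/
theorem CStarAux.tendsto_mul_self {A : Type u} [NonUnitalCStarAlgebra A] {l : Filter A}
    (hl : ∀ m : A, Tendsto (fun e => m * e) l (𝓝 m)) (hn : ∀ᶠ e in l, ‖e‖ ≤ 1) {f : A → A} {a : A}
    (hf : Tendsto f l (𝓝 a)) : Tendsto (fun e => f e * e) l (𝓝 a) := by
  have h1 : Tendsto (fun e => (f e - a) * e) l (𝓝 0) := by
    refine squeeze_zero_norm' (a := fun e => ‖f e - a‖) ?_ (by simpa using (hf.sub_const a).norm)
    filter_upwards [hn] with e he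
    exact (norm_mul_le _ _).trans (mul_le_of_le_one_right (norm_nonneg _) he)
  simpa [sub_mul] using h1.add (hl a)

/-! ### Algebraic consequences of the relation `S⋆ π(a) S = π(α(a))` -/

namespace OpRep

variable {A : Type u} [NonUnitalCStarAlgebra A] {α : A →⋆ₙₐ[ℂ] A} {R : OpRep.{u, v} A}

theorem tendsto_π_of_tendsto {l : Filter A} {f : A → A} {a : A} (h : Tendsto f l (𝓝 a)) :
    Tendsto (fun e => R.π (f e)) l (𝓝 (R.π a)) :=
  (R.π.continuous_of_cstar.tendsto a).comp h

/-- Nondegeneracy makes `π(e)` tend strongly to the identity, so multiplication by `π(A)` separates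
operators. -/
theorem ext_of_π_mul {X Y : R.H →L[ℂ] R.H} (h : ∀ a, R.π a * X = R.π a * Y) : X = Y := by
  obtain ⟨l, hl, -, hr, he⟩ := CStarAux.exists_approx A
  have hn : ∀ᶠ e in l, ‖e‖ ≤ 1 := he.mono fun e h => h.2.1
  ext k
  refine tendsto_nhds_unique (R.tendsto_π hr hn (X k)) ?_
  refine (R.tendsto_π hr hn (Y k)).congr fun e => ?_
  exact (DFunLike.congr_fun (h e) k).symm

theorem ext_of_mul_π {X Y : R.H →L[ℂ] R.H} (h : ∀ a, X * R.π a = Y * R.π a) : X = Y := by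
  refine star_injective (R.ext_of_π_mul fun a => ?_)
  have := congrArg star (h (star a))
  rwa [star_mul, star_mul, map_star, star_star] at this

namespace IsRep

/-- `S⋆ π(e) S π(α(a)) = π(α(ea))`; the left side tends strongly to `S⋆S π(α(a))`, the right side in
norm to `π(α(a))`. -/
theorem star_T_mul_T_mul_π (h : R.IsRep α) (a : A) :
    star R.T * R.T * R.π (α a) = R.π (α a) := by
  obtain ⟨l, hl, -, hr, he⟩ := CStarAux.exists_approx A
  have hn : ∀ᶠ e in l, ‖e‖ ≤ 1 := he.mono fun e h => h.2.1
  ext k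
  have h1 : Tendsto (fun e => star R.T (R.π e (R.T (R.π (α a) k)))) l
      (𝓝 (star R.T (R.T (R.π (α a) k)))) :=
    ((star R.T).continuous.tendsto _).comp (R.tendsto_π hr hn _)
  refine tendsto_nhds_unique h1 ?_
  have h2 : Tendsto (fun e => R.π (α (e * a)) k) l (𝓝 (R.π (α a) k)) :=
    ((ContinuousLinearMap.apply ℂ R.H k).continuous.tendsto _).comp
      (tendsto_π_of_tendsto ((α.continuous_of_cstar.tendsto a).comp (hr a)))
  refine h2.congr fun e => ?_
  have := DFunLike.congr_fun (h e) (R.π (α a) k)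
  rw [map_mul, map_mul]
  exact this.symm

theorem π_mul_star_T_mul_T (h : R.IsRep α) (a : A) :
    R.π (α a) * (star R.T * R.T) = R.π (α a) := by
  have := congrArg star (h.star_T_mul_T_mul_π (star a))
  simpa only [star_mul, star_star, map_star, mul_assoc] using this

/-- The `C⋆`-identity applied to the difference: each of the four terms of its square is `±
π(α(a⋆a))`. All later structure of `S` rests on this. -/
theorem π_mul_T (h : R.IsRep α) (a : A) : R.π a * R.T = R.T * R.π (α a) := by
  rw [← sub_eq_zero, ← CStarRing.star_mul_self_eq_zero_iff]
  have h1 : star R.T * R.π (star a * a) * R.T = R.π (α (star a * a)) := h _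
  have h2 : star R.T * R.π (star a) * R.T = R.π (α (star a)) := h _
  have h3 := h a
  have h4 := h.star_T_mul_T_mul_π a
  calc star (R.π a * R.T - R.T * R.π (α a)) * (R.π a * R.T - R.T * R.π (α a))
      = star R.T * R.π (star a * a) * R.T - star R.T * R.π (star a) * R.T * R.π (α a)
        - R.π (α (star a)) * (star R.T * R.π a * R.T)
        + R.π (α (star a)) * (star R.T * R.T * R.π (α a)) := by
          simp only [star_sub, star_mul, map_mul, map_star]
          noncomm_ring
    _ = 0 := by
      rw [h1, h2, h3, h4, map_mul, map_mul]
      noncomm_ring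

theorem star_T_mul_π (h : R.IsRep α) (a : A) : star R.T * R.π a = R.π (α a) * star R.T := by
  have := congrArg star (h.π_mul_T (star a))
  simpa only [star_mul, map_star, star_star] using this

theorem π_mul_T_mul_star_T (h : R.IsRep α) (a : A) :
    R.π a * (R.T * star R.T) = R.T * star R.T * R.π a := by
  rw [← mul_assoc, h.π_mul_T, mul_assoc, ← h.star_T_mul_π, mul_assoc]

theorem T_mul_star_T_mul_T (h : R.IsRep α) : R.T * star R.T * R.T = R.T := by
  refine R.ext_of_π_mul fun a => ?_
  rw [mul_assoc R.T, ← mul_assoc, h.π_mul_T, mul_assoc, h.π_mul_star_T_mul_T]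

/-- `S` itself need not lie in `C⋆(π,S)`, so `π(a)SS⋆` is reached as a norm limit of products of a
generator and the adjoint of a generator. Homomorphisms can then be evaluated on it. -/
theorem tendsto_corner (h : R.IsRep α) {l : Filter A} (hl : ∀ m : A, Tendsto (fun e => m * e) l (𝓝 m))
    (hn : ∀ᶠ e in l, ‖e‖ ≤ 1) (a : A) :
    Tendsto (fun e => R.π (a * e) * R.T * star (R.π (star e) * R.T)) l
      (𝓝 (R.π a * (R.T * star R.T))) := by
  have h0 := CStarAux.tendsto_mul_self hl hn (hl a)
  refine ((tendsto_π_of_tendsto h0).mul_const (R.T * star R.T)).congr fun e => ?_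
  rw [star_mul, ← map_star, star_star, mul_assoc (R.π (a * e)), ← mul_assoc R.T, ← h.π_mul_T_mul_star_T,
    ← mul_assoc (R.π (a * e)), ← map_mul]

theorem corner_mem_middle (h : R.IsRep α) (a : A) : R.π a * (R.T * star R.T) ∈ R.middle := by
  obtain ⟨l, hl, hl', hr, he⟩ := CStarAux.exists_approx A
  have hn : ∀ᶠ e in l, ‖e‖ ≤ 1 := he.mono fun e h => h.2.1
  have h1 : Tendsto (fun e => R.π e * (R.π a * (R.T * star R.T)) * R.π e) l
      (𝓝 (R.π a * (R.T * star R.T))) := by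
    have h2 := CStarAux.tendsto_mul_self hl' hn (hr a)
    refine ((tendsto_π_of_tendsto h2).mul_const (R.T * star R.T)).congr fun e => ?_
    rw [mul_assoc (R.π e), mul_assoc (R.π a), ← h.π_mul_T_mul_star_T]
    simp only [map_mul, mul_assoc]
  refine (Submodule.isClosed_topologicalClosure _).mem_of_tendsto h1
    (Eventually.of_forall fun e => Submodule.le_topologicalClosure _ (Submodule.subset_span ?_))
  -- The middle factor is `α(a)` because `S π(α(a)) S⋆ = π(a) SS⋆`.
  refine ⟨e, α a, e, ?_⟩
  rw [mul_assoc (R.π e), ← h.π_mul_T]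
  simp only [mul_assoc]

/-- In `π(a)Sπ(b)S⋆π(c)`, the projection `SS⋆` moves left past `π(c)` and is absorbed by `S⋆`; the
property is linear and closed. -/
theorem mul_range_of_mem_middle (h : R.IsRep α) {k : R.H →L[ℂ] R.H} (hk : k ∈ R.middle) :
    k * (R.T * star R.T) = k := by
  have hc : IsClosed {k : R.H →L[ℂ] R.H | k * (R.T * star R.T) = k} :=
    isClosed_eq (by fun_prop) continuous_id
  refine closure_minimal (fun x hx => ?_) hc hk
  change x * (R.T * star R.T) = x
  induction hx using Submodule.span_induction with
  | mem x hx =>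
    obtain ⟨a, b, c, rfl⟩ := hx
    have h1 : star R.T * (R.T * star R.T) = star R.T := by
      simpa only [star_mul, star_star] using congrArg star h.T_mul_star_T_mul_T
    rw [mul_assoc _ (R.π c), h.π_mul_T_mul_star_T]
    rw [← mul_assoc _ (R.T * star R.T), mul_assoc _ (star R.T), h1]
  | zero => rw [zero_mul]
  | add x y _ _ hx hy => rw [add_mul, hx, hy]
  | smul c x _ hx => rw [smul_mul_assoc, hx]

/-- Letting `b` run through an approximate unit turns the redundancy condition into `π(a)S = kS`.
Multiplying by `S⋆` gives `π(a)SS⋆ = kSS⋆ = k`, so redundancies exist and are unique. -/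
theorem isRedundancy_iff (h : R.IsRep α) (a : A) (k : R.H →L[ℂ] R.H) :
    R.IsRedundancy a k ↔ k = R.π a * (R.T * star R.T) := by
  constructor
  · rintro ⟨hk, hb⟩
    obtain ⟨l, hl, -, hr, he⟩ := CStarAux.exists_approx A
    have hn : ∀ᶠ e in l, ‖e‖ ≤ 1 := he.mono fun e h => h.2.1
    have h1 : R.π a * R.T = k * R.T := by
      ext x
      have h2 : Tendsto (fun e => R.π a (R.π e (R.T x))) l (𝓝 (R.π a (R.T x))) :=
        ((R.π a).continuous.tendsto _).comp (R.tendsto_π hr hn _)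
      have h3 : Tendsto (fun e => k (R.π e (R.T x))) l (𝓝 (k (R.T x))) :=
        (k.continuous.tendsto _).comp (R.tendsto_π hr hn _)
      exact tendsto_nhds_unique h2 (h3.congr fun e => (DFunLike.congr_fun (hb e) x).symm)
    rw [← mul_assoc, h1, mul_assoc, h.mul_range_of_mem_middle hk]
  · rintro rfl
    refine ⟨h.corner_mem_middle a, fun b => ?_⟩
    rw [mul_assoc (R.π a) _ (R.π b), ← h.π_mul_T_mul_star_T, mul_assoc (R.π a) (R.π b * _), mul_assoc (R.π b),
      h.T_mul_star_T_mul_T, mul_assoc]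

theorem covIdeal_eq (h : R.IsRep α) :
    R.covIdeal = {a | R.T * star R.T * R.π a = R.π a} := by
  ext a
  rw [covIdeal, Set.mem_ofPred_eq, h.isRedundancy_iff, h.π_mul_T_mul_star_T]
  exact eq_comm

end IsRep

end OpRep

/-! ### The correspondence `X_α` inside `A` and compactness of its left action -/

namespace GNSModule

variable {A : Type u} [NonUnitalCStarAlgebra A] (α : A →⋆ₙₐ[ℂ] A)

/-- With the module lemmas below, this realizes `X_α` inside `A`: `a` acts on the left by
multiplication by `α(a)`, on the right by multiplication by `a`, and operator identities can be
checked there. -/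
theorem norm_toA (x : GNSModule α) : ‖toA α x‖ = ‖x‖ := by
  induction x using UniformSpace.Completion.induction_on with
  | hp => exact isClosed_eq (UniformSpace.Completion.continuous_extension.norm) continuous_norm
  | ih x =>
    rw [toA, UniformSpace.Completion.extension_coe (uniformContinuous_toA α),
      UniformSpace.Completion.norm_coe, GNSPre.norm_def]

theorem toA_coe (x : GNSPre α) : toA α x = GNSPre.toA α x :=
  UniformSpace.Completion.extension_coe (uniformContinuous_toA α) x

@[fun_prop]
theorem continuous_toA : Continuous (toA α) := UniformSpace.Completion.continuous_extension

theorem toA_sub (x y : GNSModule α) : toA α (x - y) = toA α x - toA α y := by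
  induction x, y using UniformSpace.Completion.induction_on₂ with
  | hp => 
    exact isClosed_eq (by fun_prop) (by fun_prop)
  | ih x y => rw [← UniformSpace.Completion.coe_sub, toA_coe, toA_coe, toA_coe, map_sub]

theorem toA_left (a : A) (x : GNSModule α) : toA α (left α a x) = α a * toA α x := by
  induction x using UniformSpace.Completion.induction_on with
  | hp => exact isClosed_eq (by fun_prop) (by fun_prop)
  | ih x =>
    have : left α a (x : GNSModule α) = (GNSPre.leftL α a x : GNSPre α) :=
      ContinuousLinearMap.completion_apply_coe _ _
    rw [this, toA_coe, toA_coe]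
    exact GNSPre.toA_left α a x

theorem toA_right (a : A) (x : GNSModule α) : toA α (right α a x) = toA α x * a := by
  induction x using UniformSpace.Completion.induction_on with
  | hp => exact isClosed_eq (by fun_prop) (by fun_prop)
  | ih x =>
    have : right α a (x : GNSModule α) = (GNSPre.rightL α a x : GNSPre α) :=
      ContinuousLinearMap.completion_apply_coe _ _
    rw [this, toA_coe, toA_coe]
    exact GNSPre.toA_right α a x

theorem eq_of_toA_eq {x y : GNSModule α} (h : toA α x = toA α y) : x = y := by
  rw [← sub_eq_zero, ← norm_eq_zero, ← norm_toA, toA_sub, h, sub_self, norm_zero]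

theorem left_mul_mem_compacts (a b c d : A) : left α (a * b * (c * d)) ∈ compacts α := by
  refine Submodule.le_topologicalClosure _ (Submodule.subset_span ?_)
  -- Here `x = a ⊙ α(b)` has image `α(ab)` and `y = d⋆ ⊙ α(c)⋆` has image `α(cd)⋆`, so `Θ_{x,y}` is
  -- left multiplication by `α(ab)α(cd)`.
  refine ⟨(GNSPre.tmul α a (α b) : GNSPre α),
    (GNSPre.tmul α (star d) (star (α c)) : GNSPre α), fun z => eq_of_toA_eq α ?_⟩
  rw [toA_left, toA_right, inner, toA_coe, toA_coe, GNSPre.toA_tmul, GNSPre.toA_tmul]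
  simp only [star_mul, star_star, map_star, map_mul, mul_assoc]

theorem norm_left_sub_le (a b : A) : ‖left α a - left α b‖ ≤ ‖a - b‖ := by
  refine ContinuousLinearMap.opNorm_le_bound _ (norm_nonneg _) fun x => ?_
  rw [sub_apply, ← norm_toA, ← norm_toA α x, toA_sub, toA_left, toA_left,
    ← sub_mul, ← map_sub]
  exact (norm_mul_le _ _).trans
    (mul_le_mul_of_nonneg_right (NonUnitalStarAlgHom.norm_apply_le α _) (norm_nonneg _))

/-- The left action of an endomorphism correspondence is by generalized compact operators. -/
theorem jIdeal_eq_univ : jIdeal α = Set.univ := by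
  refine Set.eq_univ_of_forall fun a => ?_
  obtain ⟨l, hl, hl', hr, he⟩ := CStarAux.exists_approx A
  have key {f : A → A} (hf : Tendsto f l (𝓝 a)) :=
    CStarAux.tendsto_mul_self hl' (he.mono fun e h => h.2.1) hf
  -- The limit `a = lim a·e·e·e` writes `a` as a norm limit of fourfold products.
  have h1 := key (key (hl' a))
  have h2 : Tendsto (fun e => left α (a * e * (e * e))) l (𝓝 (left α a)) := by
    rw [tendsto_iff_norm_sub_tendsto_zero]
    refine squeeze_zero (fun _ => norm_nonneg _) (fun e => norm_left_sub_le α _ _) ?_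
    have := (h1.sub_const a).norm
    rw [sub_self, norm_zero] at this
    simpa only [mul_assoc] using this
  exact (Submodule.isClosed_topologicalClosure _).mem_of_tendsto h2
    (Eventually.of_forall fun e => left_mul_mem_compacts α _ _ _ _)

end GNSModule

theorem OpRep.IsRep.isCovariant_iff {A : Type u} [NonUnitalCStarAlgebra A] {α : A →⋆ₙₐ[ℂ] A}
    {R : OpRep.{u, v} A} (h : R.IsRep α) (J : Set A) :
    R.IsCovariant α J ↔ J ⊆ {a | R.T * star R.T * R.π a = R.π a} := by
  rw [IsCovariant, GNSModule.jIdeal_eq_univ, Set.inter_univ, h.covIdeal_eq]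

/-! ### Homomorphisms and generating sets -/

section Generators

variable {B : Type u} [NonUnitalCStarAlgebra B] {C : Type v} [NonUnitalCStarAlgebra C]

theorem cstarGen_le {s : Set B} {S : NonUnitalStarSubalgebra ℂ B} (hs : s ⊆ S)
    (hS : IsClosed (S : Set B)) : cstarGen s ≤ S :=
  NonUnitalStarSubalgebra.topologicalClosure_minimal _ (NonUnitalStarAlgebra.adjoin_le hs) hS

/-- Regarded as an algebra of its own, `C⋆(s)` is still generated by `s`: the inclusion is a closed
embedding, so closures inside and outside agree. -/
theorem cstarGen_eq_top_of_image {s : Set B} (S : NonUnitalStarSubalgebra ℂ B)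
    [hS : IsClosed (S : Set B)] (hs : S = cstarGen s) {t : Set S} (ht : s ⊆ Subtype.val '' t) :
    cstarGen t = ⊤ := by
  have h1 : IsClosed ((cstarGen t).map (NonUnitalStarSubalgebraClass.subtype S) : Set B) :=
    hS.isClosedEmbedding_subtypeVal.isClosedMap _ (isClosed_cstarGen t)
  have h2 : S ≤ (cstarGen t).map (NonUnitalStarSubalgebraClass.subtype S) := by
    refine hs.le.trans (cstarGen_le (fun x hx => ?_) h1)
    obtain ⟨y, hy, rfl⟩ := ht hx
    exact ⟨y, subset_cstarGen t hy, rfl⟩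
  refine eq_top_iff.mpr fun x _ => ?_
  obtain ⟨y, hy, hyx⟩ := h2 x.2
  exact Subtype.ext hyx ▸ hy

theorem NonUnitalStarAlgHom.mem_of_cstarGen_eq_top {t : Set B} (ht : cstarGen t = ⊤)
    (φ : B →⋆ₙₐ[ℂ] C) {D : NonUnitalStarSubalgebra ℂ C} (hD : IsClosed (D : Set C))
    (h : ∀ x ∈ t, φ x ∈ D) (x : B) : φ x ∈ D := by
  have h1 : cstarGen t ≤ D.comap φ := cstarGen_le h (hD.preimage φ.continuous_of_cstar)
  exact h1 (ht ▸ NonUnitalStarAlgebra.mem_top)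

theorem NonUnitalStarAlgHom.ext_of_cstarGen_eq_top {t : Set B} (ht : cstarGen t = ⊤)
    {φ ψ : B →⋆ₙₐ[ℂ] C} (h : ∀ x ∈ t, φ x = ψ x) : φ = ψ := by
  have h1 : cstarGen t ≤ NonUnitalStarAlgHom.equalizer φ ψ :=
    cstarGen_le h (isClosed_eq φ.continuous_of_cstar ψ.continuous_of_cstar)
  ext x
  exact h1 (ht ▸ NonUnitalStarAlgebra.mem_top)

theorem NonUnitalStarAlgHom.isClosed_range_of_injective (φ : B →⋆ₙₐ[ℂ] C)
    (hφ : Function.Injective φ) : IsClosed (Set.range φ) :=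
  (NonUnitalStarAlgHom.isometry φ hφ).isClosedEmbedding.isClosed_range

/-- An injective homomorphism of `C⋆`-algebras is isometric, so its range is closed; containing
generators then suffices. -/
theorem NonUnitalStarAlgHom.surjective_of_injective {t : Set C} (ht : cstarGen t = ⊤)
    (φ : B →⋆ₙₐ[ℂ] C) (hφ : Function.Injective φ) (h : t ⊆ Set.range φ) :
    Function.Surjective φ := fun x => by
  have h1 : cstarGen t ≤ NonUnitalStarAlgHom.range φ :=
    cstarGen_le (fun y hy => h hy) (φ.isClosed_range_of_injective hφ)
  exact h1 (ht ▸ NonUnitalStarAlgebra.mem_top)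

end Generators

/-! ### Homomorphisms out of quotients -/

namespace ClosedIdeal

variable {B : Type u} [NonUnitalCStarAlgebra B] {C : Type v} [NonUnitalCStarAlgebra C]

theorem subset_closedSpan (s : Set B) {x : B} (hx : x ∈ s) :
    x ∈ (closedSpan s).toTwoSidedIdeal := by
  rw [closedSpan, TwoSidedIdeal.mem_sInf]
  exact fun I hI => hI.2 hx

theorem map_eq_zero_of_mem_closedSpan {s : Set B} (φ : B →⋆ₙₐ[ℂ] C) (h : ∀ x ∈ s, φ x = 0) {x : B}
    (hx : x ∈ (closedSpan s).toTwoSidedIdeal) : φ x = 0 := by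
  rw [closedSpan, TwoSidedIdeal.mem_sInf] at hx
  have hk : ((TwoSidedIdeal.ker φ : TwoSidedIdeal B) : Set B) = {x | φ x = 0} := by
    ext y
    exact TwoSidedIdeal.mem_ker φ
  have h1 := hx (TwoSidedIdeal.ker φ) ⟨by
    rw [hk]; exact isClosed_eq φ.continuous_of_cstar continuous_const, fun y hy => by
    rw [hk]; exact h y hy⟩
  exact (TwoSidedIdeal.mem_ker φ).mp h1

namespace QuotAlg

/-- The quotient map as a homomorphism. -/
noncomputable def mkHom (I : ClosedIdeal B) : B →⋆ₙₐ[ℂ] I.QuotAlg where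
  toFun := mk I
  map_smul' c x := map_smul (mk I) c x
  map_zero' := map_zero (mk I)
  map_add' := map_add (mk I)
  map_mul' := mk_mul I
  map_star' := mk_star I

theorem mk_eq_zero (I : ClosedIdeal B) {x : B} : mk I x = 0 ↔ x ∈ I.toTwoSidedIdeal := by
  rw [← map_zero (mk I), mk_eq_mk, sub_zero]

theorem exists_lift (I : ClosedIdeal B) (φ : B →⋆ₙₐ[ℂ] C)
    (h : ∀ x ∈ I.toTwoSidedIdeal, φ x = 0) :
    ∃ Φ : I.QuotAlg →⋆ₙₐ[ℂ] C, ∀ x, Φ (mk I x) = φ x := by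
  let Φ : I.QuotAlg →ₗ[ℂ] C := I.toSubmodule.liftQ (φ : B →ₗ[ℂ] C) fun x hx => h x hx
  have hΦ : ∀ x, Φ (mk I x) = φ x := fun x => rfl
  refine ⟨{ toFun := Φ
            map_smul' := fun c x => map_smul Φ c x
            map_zero' := map_zero Φ
            map_add' := map_add Φ
            map_mul' := fun x y => ?_
            map_star' := fun x => ?_ }, hΦ⟩
  · obtain ⟨x, rfl⟩ := mk_surjective I x
    obtain ⟨y, rfl⟩ := mk_surjective I y
    change Φ (mk I x * mk I y) = Φ (mk I x) * Φ (mk I y)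
    rw [← mk_mul, hΦ, hΦ, hΦ, map_mul]
  · obtain ⟨x, rfl⟩ := mk_surjective I x
    rw [← mk_star, hΦ, hΦ, map_star]

theorem cstarGen_image_mk (I : ClosedIdeal B) {t : Set B} (ht : cstarGen t = ⊤) :
    cstarGen (mk I '' t) = ⊤ := by
  refine eq_top_iff.mpr fun x _ => ?_
  obtain ⟨x, rfl⟩ := mk_surjective I x
  exact (mkHom I).mem_of_cstarGen_eq_top ht (isClosed_cstarGen _)
    (fun y hy => subset_cstarGen (mk I '' t) ⟨y, hy, rfl⟩) x

end QuotAlg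

end ClosedIdeal

/-! ### Representations of `C⋆(W)` coming from pairs -/

namespace OpRep

variable {A : Type u} [NonUnitalCStarAlgebra A] {α : A →⋆ₙₐ[ℂ] A} {R : OpRep.{u, v} A}

theorem cstarGen_cstar (R : OpRep.{u, v} A) :
    cstarGen (Set.range R.cstarπ ∪ Set.range R.cstarπT) = ⊤ := by
  refine cstarGen_eq_top_of_image R.cstar rfl ?_
  rintro _ (⟨a, rfl⟩ | ⟨a, rfl⟩)
  · exact ⟨R.cstarπ a, Or.inl ⟨a, rfl⟩, rfl⟩
  · exact ⟨R.cstarπT a, Or.inr ⟨a, rfl⟩, rfl⟩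

/-- The inclusion of `C⋆(π(A) ∪ π(A)T)` into the bounded operators. -/
noncomputable def incl (R : OpRep.{u, v} A) : R.cstar →⋆ₙₐ[ℂ] (R.H →L[ℂ] R.H) :=
  NonUnitalStarSubalgebraClass.subtype R.cstar

theorem cstar_le_full (R : OpRep.{u, v} A) : R.cstar ≤ R.full := by
  refine cstarGen_le ?_ (isClosed_cstarGen _)
  rintro _ (⟨a, rfl⟩ | ⟨a, rfl⟩)
  · exact (R.fullπ a).2
  · exact (R.fullπ a * R.fullT).2

/-- A homomorphism `C⋆(W) → B(H_R)` sending `W.π a` to `R.π a` and `W.π a W.T` to `R.π a R.T`. -/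
def Represents {W : OpRep.{u, u} A} (R : OpRep.{u, v} A) (φ : W.cstar →⋆ₙₐ[ℂ] (R.H →L[ℂ] R.H)) :
    Prop :=
  (∀ a, φ (W.cstarπ a) = R.π a) ∧ ∀ a, φ (W.cstarπT a) = R.π a * R.T

/-- The preorder speaks of `C⋆(π(A) ∪ {T})`; restriction to the subalgebra `C⋆(π(A) ∪ π(A)T)` gives
the homomorphism. -/
theorem Below.exists_represents {R W : OpRep.{u, u} A} (h : R.Below W) :
    ∃ φ : W.cstar →⋆ₙₐ[ℂ] (R.H →L[ℂ] R.H), Represents R φ := by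
  obtain ⟨f, h1, h2⟩ := h
  refine ⟨((NonUnitalStarSubalgebraClass.subtype R.full).comp f).comp
    (NonUnitalStarSubalgebra.inclusion W.cstar_le_full), fun a => ?_, fun a => ?_⟩
  · exact congrArg Subtype.val (h1 a)
  · have h3 : f (W.fullπ a * W.fullT) = R.fullπ a * R.fullT := by rw [map_mul, h1, h2]
    exact congrArg Subtype.val h3

theorem Represents.mem_cstar {W : OpRep.{u, u} A} {R : OpRep.{u, v} A}
    {φ : W.cstar →⋆ₙₐ[ℂ] (R.H →L[ℂ] R.H)} (h : Represents R φ) (x : W.cstar) :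
    φ x ∈ R.cstar := by
  refine φ.mem_of_cstarGen_eq_top W.cstarGen_cstar (isClosed_cstarGen _) ?_ x
  rintro _ (⟨a, rfl⟩ | ⟨a, rfl⟩)
  · rw [h.1]; exact (R.cstarπ a).2
  · rw [h.2]; exact (R.cstarπT a).2

theorem IsRep.corner_mem_cstar (h : R.IsRep α) (a : A) : R.π a * (R.T * star R.T) ∈ R.cstar := by
  obtain ⟨l, hl, hl', hr, he⟩ := CStarAux.exists_approx A
  refine (isClosed_cstarGen _).mem_of_tendsto
    (h.tendsto_corner hl' (he.mono fun e h => h.2.1) a) (Eventually.of_forall fun e => ?_)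
  exact (R.cstarπT (a * e) * star (R.cstarπT (star e))).2

theorem Represents.map_corner {W : OpRep.{u, u} A} (hW : W.IsRep α) (hR : R.IsRep α)
    {φ : W.cstar →⋆ₙₐ[ℂ] (R.H →L[ℂ] R.H)} (h : Represents R φ) {a : A} {x : W.cstar}
    (hx : (x : W.H →L[ℂ] W.H) = W.π a * (W.T * star W.T)) :
    φ x = R.π a * (R.T * star R.T) := by
  obtain ⟨l, hl, hl', hr, he⟩ := CStarAux.exists_approx A
  have hn := he.mono fun e h => h.2.1
  have h1 : Tendsto (fun e => W.cstarπT (a * e) * star (W.cstarπT (star e))) l (𝓝 x) := by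
    rw [tendsto_subtype_rng, hx]
    exact hW.tendsto_corner hl' hn a
  have h2 := (φ.continuous_of_cstar.tendsto x).comp h1
  refine tendsto_nhds_unique h2 ((hR.tendsto_corner hl' hn a).congr fun e => ?_)
  rw [Function.comp_apply, map_mul φ, map_star φ, h.2, h.2]

/-- The relation bounds `‖S‖` by `1`, and both defining equations are checked coordinatewise, so the
class is closed under direct sums. -/
theorem exists_isUniversal_isRepFixing (α : A →⋆ₙₐ[ℂ] A) (J : Set A) :
    ∃ W : OpRep.{u, u} A, IsUniversal (IsRepFixing α J) W :=
  exists_isUniversal 1 zero_le_one (fun _ h => h.1.norm_le) fun _ R h =>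
    ⟨isRep_directSum R _ _ _ α fun i => (h i).1, fun a ha =>
      directSum_ext R _ _ _ fun x i => by
        rw [coord_π, ← (h i).2 ha]
        simp only [mul_apply_eq_comp, coord_star_T, coord_T, coord_π]⟩

end OpRep

/-! ### The redundancy ideal and maps out of the crossed product -/

section CrossedProducts

variable {A : Type u} [NonUnitalCStarAlgebra A] (α : A →⋆ₙₐ[ℂ] A) (J : Set A)

theorem toeplitzRep_isUniversal : OpRep.IsUniversal (OpRep.IsRep α) (toeplitzRep α) :=
  (OpRep.exists_isUniversal_isRep α).choose_spec

theorem cstarGen_crossedProduct :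
    cstarGen (Set.range (jA α J) ∪ Set.range (jAs α J)) = ⊤ := by
  have := ClosedIdeal.QuotAlg.cstarGen_image_mk (redundancyIdeal α J) (toeplitzRep α).cstarGen_cstar
  rwa [Set.image_union, ← Set.range_comp, ← Set.range_comp] at this

variable {α J}

/-- A representation of the Toeplitz algebra annihilates the redundancy ideal iff it comes from a
pair `(π, S)` for which `S S⋆` fixes `π(J)`. -/
theorem OpRep.Represents.fixing_iff {R : OpRep.{u, v} A} (hR : R.IsRep α)
    {φ : ToeplitzAlgebra α →⋆ₙₐ[ℂ] (R.H →L[ℂ] R.H)} (h : OpRep.Represents R φ) :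
    (∀ x ∈ (redundancyIdeal α J).toTwoSidedIdeal, φ x = 0) ↔
      J ⊆ {a | R.T * star R.T * R.π a = R.π a} := by
  have hW := (toeplitzRep_isUniversal α).1
  constructor
  · intro h0 a ha
    -- By uniqueness of redundancies, `k = i_A(a)tt⋆` is the only partner of `a`; its image under
    -- `φ` is `π(a)SS⋆`.
    let k : ToeplitzAlgebra α := ⟨_, hW.corner_mem_cstar a⟩
    have h1 := h0 _ (ClosedIdeal.subset_closedSpan (redundancySet α J)
      (x := (toeplitzRep α).cstarπ a - k) ⟨a, ha, _, (hW.isRedundancy_iff a _).mpr rfl, rfl⟩)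
    rw [map_sub, h.1, h.map_corner (a := a) hW hR rfl, sub_eq_zero] at h1
    exact (hR.π_mul_T_mul_star_T a).symm.trans h1.symm
  · refine fun hJ x hx => ClosedIdeal.map_eq_zero_of_mem_closedSpan φ ?_ hx
    rintro y ⟨a, ha, k, hk, hy⟩
    obtain rfl := (hW.isRedundancy_iff a k).mp hk
    have h1 : y = (toeplitzRep α).cstarπ a - ⟨_, hW.corner_mem_cstar a⟩ := Subtype.ext hy
    rw [h1, map_sub, h.1, h.map_corner (a := a) hW hR rfl, hR.π_mul_T_mul_star_T, hJ ha, sub_self]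

/-- The composite of the quotient map with `Ψ` is a representation of the Toeplitz algebra that
comes from `R` and kills the ideal. -/
theorem Generates.isRepFixing {R : OpRep.{u, v} A} {Ψ : CrossedProduct α J ≃⋆ₐ[ℂ] R.cstar}
    (h : Generates α J R Ψ) : R.IsRepFixing α J := by
  refine ⟨h.1, ?_⟩
  let ψ : CrossedProduct α J →⋆ₙₐ[ℂ] R.cstar := (Ψ : CrossedProduct α J →⋆ₙₐ[ℂ] R.cstar)
  let φ : ToeplitzAlgebra α →⋆ₙₐ[ℂ] (R.H →L[ℂ] R.H) :=
    (R.incl.comp ψ).comp (ClosedIdeal.QuotAlg.mkHom (redundancyIdeal α J))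
  have hφ : OpRep.Represents R φ :=
    ⟨fun a => congrArg Subtype.val (h.2.1 a), fun a => congrArg Subtype.val (h.2.2 a)⟩
  refine (hφ.fixing_iff h.1).mp fun x hx => ?_
  change R.incl (ψ (ClosedIdeal.QuotAlg.mk _ x)) = 0
  rw [(ClosedIdeal.QuotAlg.mk_eq_zero _).mpr hx, map_zero, map_zero]

theorem OpRep.Represents.exists_crossedProduct_hom {R : OpRep.{u, v} A} (hR : R.IsRepFixing α J)
    {φ : ToeplitzAlgebra α →⋆ₙₐ[ℂ] (R.H →L[ℂ] R.H)} (h : OpRep.Represents R φ) :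
    ∃ Φ : CrossedProduct α J →⋆ₙₐ[ℂ] R.cstar,
      (∀ a, Φ (jA α J a) = R.cstarπ a) ∧ ∀ a, Φ (jAs α J a) = R.cstarπT a := by
  obtain ⟨Φ, hΦ⟩ := ClosedIdeal.QuotAlg.exists_lift (redundancyIdeal α J)
    (NonUnitalStarAlgHom.codRestrict φ R.cstar h.mem_cstar)
    fun x hx => Subtype.ext ((h.fixing_iff hR.1).mpr hR.2 x hx)
  exact ⟨Φ, fun a => (hΦ _).trans (Subtype.ext (h.1 a)), fun a => (hΦ _).trans (Subtype.ext (h.2 a))⟩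

theorem OpRep.IsRepFixing.existsUnique_hom {R : OpRep.{u, u} A} (hR : R.IsRepFixing α J) :
    ∃! Φ : CrossedProduct α J →⋆ₙₐ[ℂ] R.cstar,
      (∀ a, Φ (jA α J a) = R.cstarπ a) ∧ ∀ a, Φ (jAs α J a) = R.cstarπT a := by
  obtain ⟨φ, hφ⟩ := ((toeplitzRep_isUniversal α).2 R hR.1).exists_represents
  obtain ⟨Φ, hΦ⟩ := hφ.exists_crossedProduct_hom hR
  refine ⟨Φ, hΦ, fun Φ' hΦ' => ?_⟩
  refine NonUnitalStarAlgHom.ext_of_cstarGen_eq_top (cstarGen_crossedProduct α J) ?_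
  rintro _ (⟨a, rfl⟩ | ⟨a, rfl⟩)
  · rw [hΦ.1, hΦ'.1]
  · rw [hΦ.2, hΦ'.2]

end CrossedProducts

/-! ### Separating an element from a closed ideal by a GNS representation -/

namespace ClosedIdeal

section Separation

open scoped ComplexOrder InnerProductSpace

variable {H : Type u} [NormedAddCommGroup H] [InnerProductSpace ℂ H] [CompleteSpace H]
  {D : NonUnitalStarSubalgebra ℂ (H →L[ℂ] H)} [IsClosed (D : Set (H →L[ℂ] H))]

/-- Bounded nets of vectors asymptotically annihilated by an ideal, but not by a given operator
outside the ideal. -/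
theorem exists_ultrafilter_vectors (I : ClosedIdeal D) {x : D} (hx : x ∉ I.toTwoSidedIdeal) :
    ∃ (U : Ultrafilter D) (k : D → H), (∀ᶠ e in U, ‖k e‖ ≤ 2) ∧
      (∀ y ∈ I.toTwoSidedIdeal, Tendsto (fun e => (y : H →L[ℂ] H) (k e)) U (𝓝 0)) ∧
      ∃ c > 0, ∀ᶠ e in U, c ≤ ‖(x : H →L[ℂ] H) (k e)‖ := by
  obtain ⟨l, hl, hr, he⟩ := I.exists_approx
  have hc : 0 < ‖QuotAlg.mk I x‖ := by
    rw [norm_pos_iff, Ne, QuotAlg.mk_eq_zero]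
    exact hx
  have h1 : ∀ e : D, ∃ h : H, ‖h‖ ≤ 1 ∧ (e ∈ I.selfAdj →
      ‖QuotAlg.mk I x‖ / 2 ≤ ‖((x - x * e : D) : H →L[ℂ] H) h‖) := by
    intro e
    by_cases hmem : e ∈ I.selfAdj
    · have h2 : QuotAlg.mk I x = QuotAlg.mk I (x - x * e) := by
        rw [QuotAlg.mk_eq_mk, sub_sub_cancel]
        exact I.toTwoSidedIdeal.mul_mem_left _ _ hmem.1
      have h3 : ‖QuotAlg.mk I x‖ / 2 < ‖((x - x * e : D) : H →L[ℂ] H)‖ := by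
        have h4 : ‖QuotAlg.mk I (x - x * e)‖ ≤ ‖x - x * e‖ := QuotAlg.norm_mk_le I _
        rw [← h2] at h4
        exact (half_lt_self hc).trans_le h4
      obtain ⟨h, h5, h6⟩ := ContinuousLinearMap.exists_lt_apply_of_lt_opNorm _ h3
      exact ⟨h, h5.le, fun _ => h6.le⟩
    · exact ⟨0, by simp, fun h => absurd h hmem⟩
  choose h h2 h3 using h1
  -- The vectors are `(1 - e)h_e`: elements `y` of the ideal act on them as `(y - ye)h_e → 0`, while
  -- `x` acts as `(x - xe)h_e`, bounded below.
  refine ⟨Ultrafilter.of l, fun e => h e - (e : H →L[ℂ] H) (h e), ?_, fun y hy => ?_,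
    ‖QuotAlg.mk I x‖ / 2, half_pos hc, ?_⟩
  · filter_upwards [Ultrafilter.of_le l he] with e ⟨_, _, h5, _⟩
    have h6 : ‖(e : H →L[ℂ] H) (h e)‖ ≤ 1 :=
      ((e : H →L[ℂ] H).le_opNorm _).trans (mul_le_one₀ h5 (norm_nonneg _) (h2 e))
    linarith [norm_sub_le (h e) ((e : H →L[ℂ] H) (h e)), h2 e]
  · have h5 : Tendsto (fun e => ‖y - y * e‖) l (𝓝 0) := by
      have := (tendsto_const_nhds (x := y)).sub (hr y ⟨hy, I.star_mem hy⟩)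
      simpa using this.norm
    refine squeeze_zero_norm (fun e => ?_) (h5.mono_left (Ultrafilter.of_le l))
    have h6 := ((y - y * e : D) : H →L[ℂ] H).le_opNorm (h e)
    rw [map_sub]
    exact h6.trans (mul_le_of_le_one_right (norm_nonneg _) (h2 e))
  · filter_upwards [Ultrafilter.of_le l he] with e ⟨h4, _⟩
    rw [map_sub]
    exact h3 e h4

/-- A limit of vector functionals along an ultrafilter. -/
theorem exists_limit_functional (U : Ultrafilter D) {k : D → H} (hk : ∀ᶠ e in U, ‖k e‖ ≤ 2) :
    ∃ f : D →ₗ[ℂ] ℂ, ∀ d : D, Tendsto (fun e => ⟪k e, (d : H →L[ℂ] H) (k e)⟫_ℂ) U (𝓝 (f d)) := by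
  have h1 : ∀ d : D, ∃ z : ℂ, Tendsto (fun e => ⟪k e, (d : H →L[ℂ] H) (k e)⟫_ℂ) U (𝓝 z) := by
    intro d
    -- The values lie eventually in a compact disc, so an ultrafilter makes them converge.
    obtain ⟨z, -, hz⟩ := (isCompact_closedBall (0 : ℂ) (2 * (‖d‖ * 2))).ultrafilter_le_nhds
      (U.map fun e => ⟪k e, (d : H →L[ℂ] H) (k e)⟫_ℂ) (by
        rw [Ultrafilter.coe_map, le_principal_iff, mem_map]
        filter_upwards [hk] with e he
        rw [Set.mem_preimage, mem_closedBall_zero_iff]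
        refine (norm_inner_le_norm _ _).trans ?_
        have h2 : ‖(d : H →L[ℂ] H) (k e)‖ ≤ ‖d‖ * 2 :=
          ((d : H →L[ℂ] H).le_opNorm _).trans (mul_le_mul_of_nonneg_left he (norm_nonneg _))
        gcongr)
    exact ⟨z, hz⟩
  choose f hf using h1
  exact ⟨{ toFun := f
           map_add' := fun a b => tendsto_nhds_unique (hf (a + b)) (((hf a).add (hf b)).congr
             fun e => (inner_add_right _ _ _).symm)
           map_smul' := fun c a => tendsto_nhds_unique (hf (c • a)) (((hf a).const_mul c).congr
             fun e => (inner_smul_right _ _ _).symm) }, hf⟩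

/-- The GNS construction for a bounded functional that is nonnegative on the elements `d⋆ d`. -/
theorem exists_gns {D : Type u} [NonUnitalCStarAlgebra D] (f₀ : D →ₗ[ℂ] ℂ)
    (hpos : ∀ d, 0 ≤ f₀ (star d * d)) {C : ℝ} (hC : ∀ d, ‖f₀ d‖ ≤ C ^ 2 * ‖d‖) (hC0 : 0 ≤ C) :
    ∃ (K : Type u) (_ : NormedAddCommGroup K) (_ : InnerProductSpace ℂ K) (_ : CompleteSpace K)
      (ρ : D →⋆ₙₐ[ℂ] (K →L[ℂ] K)) (ι : D → K), Continuous ι ∧ DenseRange ι ∧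
      (∀ d d', ρ d (ι d') = ι (d * d')) ∧ ∀ d, ‖ι d‖ = √(f₀ (star d * d)).re := by
  let _ := CStarAlgebra.spectralOrder D
  have := CStarAlgebra.spectralOrderedRing D
  have hpos' : ∀ d : D, 0 ≤ d → 0 ≤ f₀ d := fun d hd => by
    obtain ⟨y, rfl⟩ := CStarAlgebra.nonneg_iff_eq_star_mul_self.mp hd
    exact hpos y
  let f : D →ₚ[ℂ] ℂ := PositiveLinearMap.mk₀ f₀ hpos'
  let ι₀ : D →ₗ[ℂ] f.PreGNS := f.toPreGNS
  have hι₀ : ∀ d, ‖ι₀ d‖ = √(f₀ (star d * d)).re := fun d => f.preGNS_norm_def _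
  -- The bound `C²` on the functional gives `f₀(d⋆d) ≤ (C‖d‖)²`, hence continuity of the map into
  -- the GNS space.
  have hbd : ∀ d, ‖ι₀ d‖ ≤ C * ‖d‖ := by
    intro d
    rw [hι₀]
    refine Real.sqrt_le_iff.mpr ⟨by positivity, ?_⟩
    refine (Complex.re_le_norm _).trans ((hC _).trans (le_of_eq ?_))
    rw [CStarRing.norm_star_mul_self]
    ring
  refine ⟨f.GNS, inferInstance, inferInstance, inferInstance, f.gnsNonUnitalStarAlgHom,
    fun d => (ι₀ d : f.GNS), ?_, ?_, fun d d' => f.gnsNonUnitalStarAlgHom_apply_coe, fun d => ?_⟩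
  · exact (UniformSpace.Completion.continuous_coe _).comp
      (AddMonoidHomClass.continuous_of_bound ι₀ C hbd)
  · have h1 : DenseRange ((↑) : f.PreGNS → f.GNS) := UniformSpace.Completion.denseRange_coe
    exact h1
  · rw [UniformSpace.Completion.norm_coe, hι₀]

/-- An element outside a closed ideal is not annihilated by some cyclic representation that
annihilates the ideal. -/
theorem exists_separating_rep (I : ClosedIdeal D) {x : D} (hx : x ∉ I.toTwoSidedIdeal) :
    ∃ (K : Type u) (_ : NormedAddCommGroup K) (_ : InnerProductSpace ℂ K) (_ : CompleteSpace K)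
      (ρ : D →⋆ₙₐ[ℂ] (K →L[ℂ] K)) (ι : D → K), Continuous ι ∧ DenseRange ι ∧
      (∀ d d', ρ d (ι d') = ι (d * d')) ∧ (∀ y ∈ I.toTwoSidedIdeal, ρ y = 0) ∧ ρ x ≠ 0 := by
  obtain ⟨U, k, hk, hI, c, hc, hkx⟩ := I.exists_ultrafilter_vectors hx
  obtain ⟨f, hf⟩ := exists_limit_functional U hk
  -- The limit functional satisfies `f(d⋆d) = lim ‖d k_e‖²`. This gives positivity, vanishing for
  -- `d` in the ideal, and a positive lower bound for `d = x`.
  have hsq : ∀ d : D, Tendsto (fun e => ((‖(d : H →L[ℂ] H) (k e)‖ ^ 2 : ℝ) : ℂ)) U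
      (𝓝 (f (star d * d))) := by
    refine fun d => (hf (star d * d)).congr fun e => ?_
    have h1 : ((star d * d : D) : H →L[ℂ] H) (k e)
        = (star (d : H →L[ℂ] H)) ((d : H →L[ℂ] H) (k e)) := rfl
    rw [h1, ContinuousLinearMap.star_eq_adjoint, ContinuousLinearMap.adjoint_inner_right,
      inner_self_eq_norm_sq_to_K]
    norm_cast
  have hsqr : ∀ d : D, Tendsto (fun e => ‖(d : H →L[ℂ] H) (k e)‖ ^ 2) U
      (𝓝 (f (star d * d)).re) := fun d =>
    (Complex.continuous_re.tendsto _).comp (hsq d)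
  have hpos : ∀ d : D, 0 ≤ f (star d * d) := fun d =>
    ge_of_tendsto (hsq d) (Eventually.of_forall fun e => by
      rw [Complex.zero_le_real]; positivity)
  have hnorm : ∀ d : D, ‖f d‖ ≤ 2 ^ 2 * ‖d‖ := by
    intro d
    refine le_of_tendsto (hf d).norm ?_
    filter_upwards [hk] with e he
    refine (norm_inner_le_norm _ _).trans ?_
    have h2 : ‖(d : H →L[ℂ] H) (k e)‖ ≤ ‖d‖ * 2 :=
      ((d : H →L[ℂ] H).le_opNorm _).trans (mul_le_mul_of_nonneg_left he (norm_nonneg _))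
    calc ‖k e‖ * ‖(d : H →L[ℂ] H) (k e)‖ ≤ 2 * (‖d‖ * 2) := by gcongr
      _ = 2 ^ 2 * ‖d‖ := by ring
  obtain ⟨K, i1, i2, i3, ρ, ι, hc1, hd, hρ, hι⟩ := exists_gns f hpos hnorm zero_le_two
  have hzero : ∀ d : D, ι d = 0 → (f (star d * d)).re = 0 := by
    intro d h
    have h1 := hι d
    rw [h, norm_zero, eq_comm, Real.sqrt_eq_zero (Complex.nonneg_iff.mp (hpos d)).1] at h1
    exact h1
  refine ⟨K, i1, i2, i3, ρ, ι, hc1, hd, hρ, fun y hy => ?_, fun h0 => ?_⟩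
  · refine ContinuousLinearMap.ext fun z => ?_
    induction z using hd.induction_on with
    | hp => exact isClosed_eq (by fun_prop) (by fun_prop)
    | ih z =>
      have h1 : Tendsto (fun e => ‖((y * z : D) : H →L[ℂ] H) (k e)‖ ^ 2) U (𝓝 0) := by
        simpa using (hI _ (I.toTwoSidedIdeal.mul_mem_right y z hy)).norm.pow 2
      rw [hρ, zero_apply, ← norm_eq_zero, hι, tendsto_nhds_unique (hsqr _) h1, Real.sqrt_zero]
  -- An approximate unit replaces a cyclic vector: if `ρ(x) = 0` then `ι(x) = lim ι(xe) = lim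
  -- ρ(x)ι(e) = 0`, against `‖ι(x)‖² = f(x⋆x) ≥ c²`.
  · obtain ⟨l, hl, hl', -, -⟩ := CStarAux.exists_approx D
    have h1 : ι x = 0 := by
      refine tendsto_nhds_unique ((hc1.tendsto x).comp (hl' x)) ?_
      refine tendsto_const_nhds.congr fun e => ?_
      rw [Function.comp_apply, ← hρ, h0, zero_apply]
    have h2 : c ^ 2 ≤ (f (star x * x)).re := by
      refine ge_of_tendsto (hsqr x) ?_
      filter_upwards [hkx] with e he
      gcongr
    rw [hzero x h1] at h2
    exact absurd h2 (not_le.mpr (by positivity))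

end Separation

end ClosedIdeal

/-! ### Pointwise limits of contractions -/

section Limits

variable {𝕜 E β : Type*} [NontriviallyNormedField 𝕜] [NormedAddCommGroup E] [NormedSpace 𝕜 E]

theorem isClosed_setOf_tendsto_of_contractive {l : Filter β} {L : β → E →L[𝕜] E}
    (hL : ∀ᶠ e in l, ‖L e‖ ≤ 1) : IsClosed {x | Tendsto (fun e => L e x) l (𝓝 x)} := by
  refine isClosed_of_closure_subset fun k hk => ?_
  change Tendsto _ _ _
  rw [Metric.tendsto_nhds]
  intro ε hε
  obtain ⟨m, hm, hkm⟩ := Metric.mem_closure_iff.mp hk (ε / 3) (by positivity)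
  filter_upwards [hL, Metric.tendsto_nhds.mp hm (ε / 3) (by positivity)] with e h2 h3
  have h4 : dist (L e k) (L e m) ≤ dist k m := by
    rw [dist_eq_norm, dist_eq_norm, ← map_sub]
    exact ((L e).le_opNorm _).trans (mul_le_of_le_one_left (norm_nonneg _) h2)
  have h5 := dist_triangle4 (L e k) (L e m) m k
  rw [dist_comm m k] at h5
  linarith

/-- Uniform boundedness carries the Cauchy property from the dense span to all vectors, and
completeness provides the limits. -/
theorem ContinuousLinearMap.exists_tendsto_of_contractive [CompleteSpace E] {l : Filter β} [l.NeBot]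
    {L : β → E →L[𝕜] E} (hL : ∀ᶠ e in l, ‖L e‖ ≤ 1) {s : Set E}
    (hs : Dense (Submodule.span 𝕜 s : Set E))
    (h : ∀ k ∈ s, ∃ y, Tendsto (fun e => L e k) l (𝓝 y)) :
    ∃ V : E →L[𝕜] E, ∀ k, Tendsto (fun e => L e k) l (𝓝 (V k)) := by
  have h1 : ∀ m ∈ Submodule.span 𝕜 s, ∃ y, Tendsto (fun e => L e m) l (𝓝 y) := by
    intro m hm
    induction hm using Submodule.span_induction with
    | mem x hx => exact h x hx
    | zero => exact ⟨0, by simp⟩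
    | add x y _ _ hx hy =>
      obtain ⟨a, ha⟩ := hx
      obtain ⟨b, hb⟩ := hy
      exact ⟨a + b, by simpa using ha.add hb⟩
    | smul c x _ hx =>
      obtain ⟨a, ha⟩ := hx
      exact ⟨c • a, by simpa using ha.const_smul c⟩
  have h2 : ∀ k, ∃ y, Tendsto (fun e => L e k) l (𝓝 y) := by
    intro k
    rw [← cauchy_map_iff_exists_tendsto, Metric.cauchy_iff]
    refine ⟨inferInstance, fun ε hε => ?_⟩
    obtain ⟨m, hm, hkm⟩ := Metric.mem_closure_iff.mp (hs k) (ε / 4) (by positivity)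
    obtain ⟨y, hy⟩ := h1 m hm
    refine ⟨Metric.ball y (ε / 2), ?_, fun a ha b hb => ?_⟩
    · rw [mem_map]
      filter_upwards [hL, Metric.tendsto_nhds.mp hy (ε / 4) (by positivity)] with e h2 h3
      have h4 : dist (L e k) (L e m) ≤ dist k m := by
        rw [dist_eq_norm, dist_eq_norm, ← map_sub]
        exact ((L e).le_opNorm _).trans (mul_le_of_le_one_left (norm_nonneg _) h2)
      rw [Set.mem_preimage, Metric.mem_ball]
      linarith [dist_triangle (L e k) (L e m) y]
    · rw [Metric.mem_ball] at ha hb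
      linarith [dist_triangle_right a b y]
  choose V hV using h2
  refine ⟨LinearMap.mkContinuous
    { toFun := V
      map_add' := fun x y => tendsto_nhds_unique (hV (x + y)) (by simpa using (hV x).add (hV y))
      map_smul' := fun c x => tendsto_nhds_unique (hV (c • x)) (by simpa using (hV x).const_smul c) }
    1 fun k => ?_, hV⟩
  refine le_of_tendsto (hV k).norm ?_
  filter_upwards [hL] with e he
  exact ((L e).le_opNorm k).trans (mul_le_mul_of_nonneg_right he (norm_nonneg _))

end Limits

/-! ### Approximate units of `A` in `C⋆(π,S)` and recovery of `S` -/

namespace OpRep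

variable {A : Type u} [NonUnitalCStarAlgebra A] {α : A →⋆ₙₐ[ℂ] A}

/-- The operators on which `π(e)` acts as a left approximate unit, together with their adjoints,
form a closed ⋆-subalgebra. It contains `π(a)S` because `(π(a)S)⋆ = π(α(a⋆))S⋆` again begins with a
factor from `π(A)`. -/
theorem IsRep.tendsto_π_mul {R : OpRep.{u, v} A} (h : R.IsRep α) {l : Filter A}
    (hr : ∀ m : A, Tendsto (fun e => e * m) l (𝓝 m)) (hn : ∀ᶠ e in l, ‖e‖ ≤ 1)
    {x : R.H →L[ℂ] R.H} (hx : x ∈ R.cstar) : Tendsto (fun e => R.π e * x) l (𝓝 x) := by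
  have hcl : IsClosed {x : R.H →L[ℂ] R.H | Tendsto (fun e => R.π e * x) l (𝓝 x)} := by
    refine isClosed_setOf_tendsto_of_contractive (𝕜 := ℂ)
      (L := fun e => ContinuousLinearMap.mul ℂ (R.H →L[ℂ] R.H) (R.π e)) ?_
    filter_upwards [hn] with e he
    exact (ContinuousLinearMap.opNorm_mul_apply_le _ _ _).trans
      ((NonUnitalStarAlgHom.norm_apply_le R.π e).trans he)
  let E : NonUnitalStarSubalgebra ℂ (R.H →L[ℂ] R.H) :=
    { carrier := {x | Tendsto (fun e => R.π e * x) l (𝓝 x) ∧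
        Tendsto (fun e => R.π e * star x) l (𝓝 (star x))}
      add_mem' := fun ha hb => ⟨by simpa only [mul_add] using ha.1.add hb.1,
        by simpa only [star_add, mul_add] using ha.2.add hb.2⟩
      zero_mem' := ⟨by simpa only [mul_zero] using tendsto_const_nhds,
        by simpa only [star_zero, mul_zero] using tendsto_const_nhds⟩
      mul_mem' := fun {a b} ha hb => ⟨by simpa only [mul_assoc] using ha.1.mul_const b,
        by simpa only [star_mul, mul_assoc] using hb.2.mul_const (star a)⟩
      smul_mem' := fun c a ha => ⟨by simpa only [mul_smul_comm] using ha.1.const_smul c,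
        by simpa only [star_smul, mul_smul_comm] using ha.2.const_smul (star c)⟩
      star_mem' := fun ha => ⟨ha.2, by simpa only [star_star] using ha.1⟩ }
  have hE : IsClosed (E : Set (R.H →L[ℂ] R.H)) := hcl.inter (hcl.preimage continuous_star)
  have hπ : ∀ a, Tendsto (fun e => R.π e * R.π a) l (𝓝 (R.π a)) := fun a => by
    simpa only [map_mul] using tendsto_π_of_tendsto (R := R) (hr a)
  have h1 : R.cstar ≤ E := by
    refine cstarGen_le ?_ hE
    rintro _ (⟨a, rfl⟩ | ⟨a, rfl⟩)
    · exact ⟨hπ a, by simpa only [map_star] using hπ (star a)⟩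
    · refine ⟨by simpa only [mul_assoc] using (hπ a).mul_const R.T, ?_⟩
      rw [star_mul, ← map_star, h.star_T_mul_π]
      simpa only [mul_assoc] using (hπ (α (star a))).mul_const (star R.T)
  exact (h1 hx).1

theorem IsRep.tendsto_mul_π {R : OpRep.{u, v} A} (h : R.IsRep α) {l : Filter A}
    (hr : ∀ m : A, Tendsto (fun e => e * m) l (𝓝 m)) (he : ∀ᶠ e in l, star e = e ∧ ‖e‖ ≤ 1)
    {x : R.H →L[ℂ] R.H} (hx : x ∈ R.cstar) : Tendsto (fun e => x * R.π e) l (𝓝 x) := by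
  have h1 := (continuous_star.tendsto _).comp
    (h.tendsto_π_mul hr (he.mono fun e h => h.2) (star_mem hx))
  rw [star_star] at h1
  refine h1.congr' ?_
  filter_upwards [he] with e he
  rw [Function.comp_apply, star_mul, star_star, ← map_star, he.1]

/-- A nondegenerate representation of `C⋆(W)` comes from a pair. -/
theorem IsRep.exists_represents {W : OpRep.{u, u} A} (hW : W.IsRep α) {K : Type u}
    [NormedAddCommGroup K] [InnerProductSpace ℂ K] [CompleteSpace K]
    (ρ : W.cstar →⋆ₙₐ[ℂ] (K →L[ℂ] K))
    (hρ : Dense (Submodule.span ℂ {x : K | ∃ a h, ρ (W.cstarπ a) h = x} : Set K)) :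
    ∃ T : K →L[ℂ] K, (∀ a, ρ (W.cstarπ a) * T = ρ (W.cstarπT a)) ∧
      ∀ a, star T * ρ (W.cstarπ a) * T = ρ (W.cstarπ (α a)) := by
  obtain ⟨l, hl, hl', hr, he⟩ := CStarAux.exists_approx A
  have h0 : ∀ x : W.H →L[ℂ] W.H, ∀ e, star e = e →
      star (W.π e * W.T) * x = star W.T * (W.π e * x) := fun x e he => by
    rw [star_mul, ← map_star, he, mul_assoc]
  -- The adjoint is constructed first: `S⋆π(a) = (π(a⋆)S)⋆` always lies in `C⋆(W)` and is the norm
  -- limit of `(π(e)S)⋆π(a)`, whereas `Sπ(a)` need not belong to `C⋆(W)`.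
  have h1 : ∀ a h, Tendsto (fun e => ρ (star (W.cstarπT e)) (ρ (W.cstarπ a) h)) l
      (𝓝 (ρ (star (W.cstarπT (star a))) h)) := by
    intro a h
    have h2 : Tendsto (fun e => star (W.cstarπT e) * W.cstarπ a) l (𝓝 (star (W.cstarπT (star a)))) := by
      rw [tendsto_subtype_rng]
      have h3 := (tendsto_π_of_tendsto (R := W) (hr a)).const_mul (star W.T)
      have h4 : ((star (W.cstarπT (star a)) : W.cstar) : W.H →L[ℂ] W.H) = star W.T * W.π a := by
        change star (W.π (star a) * W.T) = _
        rw [star_mul, ← map_star, star_star]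
      rw [h4]
      refine h3.congr' ?_
      filter_upwards [he] with e he
      rw [map_mul]
      exact (h0 _ e he.1).symm
    have h3 := ((ContinuousLinearMap.apply ℂ K h).continuous.tendsto _).comp
      ((ρ.continuous_of_cstar.tendsto _).comp h2)
    refine h3.congr fun e => ?_
    simp only [Function.comp_apply, map_mul ρ]
    rfl
  have hbd : ∀ᶠ e in l, ‖ρ (star (W.cstarπT e))‖ ≤ 1 := by
    filter_upwards [he] with e he
    refine (NonUnitalStarAlgHom.norm_apply_le ρ _).trans ?_
    refine (norm_star (W.cstarπT e)).le.trans ?_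
    refine (norm_mul_le (W.π e) W.T).trans (mul_le_one₀ ?_ (norm_nonneg _) hW.norm_le)
    exact (NonUnitalStarAlgHom.norm_apply_le W.π e).trans he.2.1
  obtain ⟨V, hV⟩ := ContinuousLinearMap.exists_tendsto_of_contractive hbd hρ (by
    rintro _ ⟨a, h, rfl⟩
    exact ⟨_, h1 a h⟩)
  have h2 : ∀ a, V * ρ (W.cstarπ a) = ρ (star (W.cstarπT (star a))) := fun a =>
    ContinuousLinearMap.ext fun h => tendsto_nhds_unique (hV _) (h1 a h)
  have h3 : ∀ a, ρ (W.cstarπ a) * star V = ρ (W.cstarπT a) := by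
    intro a
    have h4 := congrArg star (h2 (star a))
    have h5 : star (W.cstarπ (star a)) = W.cstarπ a :=
      Subtype.ext ((map_star W.π (star a)).symm.trans (by rw [star_star]; rfl))
    rwa [star_mul, ← map_star ρ, ← map_star ρ, star_star, star_star, h5] at h4
  -- For `T = V⋆`, the relation follows from `(π(e)S)⋆ π(a)S = π(α(ea)) → π(α(a))` in norm.
  refine ⟨star V, h3, fun a => ?_⟩
  rw [star_star, mul_assoc, h3]
  refine ContinuousLinearMap.ext fun h => tendsto_nhds_unique (hV _) ?_
  have h4 : Tendsto (fun e => star (W.cstarπT e) * W.cstarπT a) l (𝓝 (W.cstarπ (α a))) := by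
    rw [tendsto_subtype_rng]
    have h5 := tendsto_π_of_tendsto (R := W) ((α.continuous_of_cstar.tendsto _).comp (hr a))
    refine h5.congr' ?_
    filter_upwards [he] with e he
    rw [Function.comp_apply, ← hW, map_mul]
    exact (mul_assoc _ _ _).trans ((congrArg (star W.T * ·) (mul_assoc _ _ _)).trans
      (h0 (W.π a * W.T) e he.1).symm)
  have h5 := ((ContinuousLinearMap.apply ℂ K h).continuous.tendsto _).comp
    ((ρ.continuous_of_cstar.tendsto _).comp h4)
  refine h5.congr fun e => ?_
  simp only [Function.comp_apply, map_mul ρ]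
  rfl

end OpRep

/-! ### Universal fixing pairs generate the crossed product -/

section CrossedProducts

variable {A : Type u} [NonUnitalCStarAlgebra A] {α : A →⋆ₙₐ[ℂ] A} {J : Set A}

/-- The elements outside the redundancy ideal are detected by representations fixing `J`. -/
theorem exists_represents_ne_zero {x : ToeplitzAlgebra α}
    (hx : x ∉ (redundancyIdeal α J).toTwoSidedIdeal) :
    ∃ (R : OpRep.{u, u} A) (φ : ToeplitzAlgebra α →⋆ₙₐ[ℂ] (R.H →L[ℂ] R.H)),
      R.IsRepFixing α J ∧ OpRep.Represents R φ ∧ φ x ≠ 0 := by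
  have hW := (toeplitzRep_isUniversal α).1
  obtain ⟨K, i1, i2, i3, ρ, ι, hι, hd, hρ, h0, hne⟩ :=
    (redundancyIdeal α J).exists_separating_rep hx
  obtain ⟨l, hl, hl', hr, he⟩ := CStarAux.exists_approx A
  -- Nondegeneracy on `A`: every `ι(d)` is the limit of `ι(i_A(e)d) = ρ(i_A(e))ι(d)`.
  have hdense : Dense (Submodule.span ℂ
      {x : K | ∃ a h, ρ ((toeplitzRep α).cstarπ a) h = x} : Set K) := by
    refine Dense.of_closure (hd.mono ?_)
    rintro _ ⟨d, rfl⟩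
    have h1 : Tendsto (fun e => (toeplitzRep α).cstarπ e * d) l (𝓝 d) := by
      rw [tendsto_subtype_rng]
      exact hW.tendsto_π_mul hr (he.mono fun e h => h.2.1) d.2
    refine mem_closure_of_tendsto ((hι.tendsto d).comp h1) (Eventually.of_forall fun e => ?_)
    exact Submodule.subset_span ⟨e, ι d, hρ _ _⟩
  obtain ⟨T, hT, hTα⟩ := hW.exists_represents ρ hdense
  let π : A →⋆ₙₐ[ℂ] (toeplitzRep α).cstar :=
    NonUnitalStarAlgHom.codRestrict (toeplitzRep α).π _ fun a => ((toeplitzRep α).cstarπ a).2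
  let R : OpRep.{u, u} A := { H := K, π := ρ.comp π, nondegenerate := hdense, T := T }
  have hR : OpRep.Represents R ρ := ⟨fun a => rfl, fun a => (hT a).symm⟩
  have hRα : R.IsRep α := hTα
  exact ⟨R, ρ, ⟨hRα, (hR.fixing_iff hRα).mp h0⟩, hR, hne⟩

theorem exists_generates_of_isUniversal {W : OpRep.{u, u} A}
    (hW : OpRep.IsUniversal (OpRep.IsRepFixing α J) W) :
    ∃ Ψ : CrossedProduct α J ≃⋆ₐ[ℂ] W.cstar, Generates α J W Ψ := by
  obtain ⟨Φ, ⟨h1, h2⟩, -⟩ := hW.1.existsUnique_hom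
  have hinj : Function.Injective Φ := by
    rw [injective_iff_map_eq_zero]
    intro q hq
    obtain ⟨x, rfl⟩ := ClosedIdeal.QuotAlg.mk_surjective _ q
    rw [ClosedIdeal.QuotAlg.mk_eq_zero]
    by_contra hx
    obtain ⟨R, φ, hR, hφ, hne⟩ := exists_represents_ne_zero hx
    obtain ⟨ψ, hψ⟩ := (hW.2 R hR).exists_represents
    -- The detecting representation factors through `Φ` by universality of `W`, so it would vanish
    -- on a class in the kernel of `Φ`.
    have h3 : (ψ.comp Φ).comp (ClosedIdeal.QuotAlg.mkHom (redundancyIdeal α J)) = φ := by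
      refine NonUnitalStarAlgHom.ext_of_cstarGen_eq_top (toeplitzRep α).cstarGen_cstar ?_
      rintro _ (⟨a, rfl⟩ | ⟨a, rfl⟩)
      · exact (congrArg ψ (h1 a)).trans ((hψ.1 a).trans (hφ.1 a).symm)
      · exact (congrArg ψ (h2 a)).trans ((hψ.2 a).trans (hφ.2 a).symm)
    refine hne ?_
    rw [← h3]
    exact (congrArg ψ hq).trans (map_zero ψ)
  have hsurj : Function.Surjective Φ := by
    refine Φ.surjective_of_injective W.cstarGen_cstar hinj ?_
    rintro _ (⟨a, rfl⟩ | ⟨a, rfl⟩)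
    · exact ⟨_, h1 a⟩
    · exact ⟨_, h2 a⟩
  exact ⟨StarAlgEquiv.ofBijective Φ ⟨hinj, hsurj⟩, hW.1.1, h1, h2⟩

end CrossedProducts

/-! ### Extendible endomorphisms: `S` multiplies `C⋆(π,S)` -/

section Extendible

variable {A : Type u} [NonUnitalCStarAlgebra A] {α : A →⋆ₙₐ[ℂ] A}

/-- An approximate unit converges strictly to `1`, so `α(e)` converges strictly to `β(1)`; only
continuity of the extension at `1` enters. -/
theorem IsExtendible.exists_tendsto (hα : IsExtendible α) {l : Filter A}
    (hl : ∀ m : A, Tendsto (fun e => m * e) l (𝓝 m))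
    (hr : ∀ m : A, Tendsto (fun e => e * m) l (𝓝 m)) (b : A) :
    ∃ c, Tendsto (fun e => α e * b) l (𝓝 c) := by
  obtain ⟨β, hβ, hβα⟩ := hα
  let _ : TopologicalSpace 𝓜(ℂ, A) := strictTopology A
  have h1 : Tendsto (fun e => (DoubleCentralizer.coe ℂ e : 𝓜(ℂ, A))) l (𝓝 1) := by
    rw [nhds_induced, tendsto_comap_iff]
    refine Tendsto.prodMk_nhds (tendsto_pi_nhds.mpr hr) (tendsto_pi_nhds.mpr hl)
  have h2 := (hβ.tendsto 1).comp h1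
  rw [nhds_induced, tendsto_comap_iff] at h2
  have h3 := tendsto_pi_nhds.mp ((continuous_fst.tendsto _).comp h2) b
  refine ⟨_, h3.congr fun e => ?_⟩
  change (β (DoubleCentralizer.coe ℂ e)).fst b = _
  rw [hβα]
  rfl

namespace OpRep.IsRep

variable {R : OpRep.{u, v} A}

theorem T_mul_π_mem_cstar (h : R.IsRep α) (hα : IsExtendible α) (a : A) :
    R.T * R.π a ∈ R.cstar := by
  obtain ⟨l, hl, hl', hr, he⟩ := CStarAux.exists_approx A
  obtain ⟨c, hc⟩ := hα.exists_tendsto hl' hr a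
  have h1 : Tendsto (fun e => R.π e * R.T * R.π a) l (𝓝 (R.T * R.π c)) := by
    refine ((tendsto_π_of_tendsto (R := R) hc).const_mul R.T).congr fun e => ?_
    rw [map_mul, h.π_mul_T, mul_assoc]
  -- The net `π(e)Sπ(a)` converges in norm to `Sπ(c)` and strongly to `Sπ(a)`; so `Sπ(a)` is a norm
  -- limit of elements of the algebra.
  have h2 : R.T * R.π c = R.T * R.π a := by
    ext k
    have h3 := ((ContinuousLinearMap.apply ℂ R.H k).continuous.tendsto _).comp h1
    exact tendsto_nhds_unique h3
      (R.tendsto_π hr (he.mono fun e h => h.2.1) (R.T (R.π a k)))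
  rw [← h2]
  refine (isClosed_cstarGen _).mem_of_tendsto h1 (Eventually.of_forall fun e => ?_)
  exact (R.cstarπT e * R.cstarπ a).2

theorem T_mul_mem_cstar (h : R.IsRep α) (hα : IsExtendible α) {x : R.H →L[ℂ] R.H}
    (hx : x ∈ R.cstar) : R.T * x ∈ R.cstar := by
  obtain ⟨l, hl, hl', hr, he⟩ := CStarAux.exists_approx A
  refine (isClosed_cstarGen _).mem_of_tendsto
    ((h.tendsto_π_mul hr (he.mono fun e h => h.2.1) hx).const_mul R.T)
    (Eventually.of_forall fun e => ?_)
  rw [← mul_assoc]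
  exact R.cstar.mul_mem (h.T_mul_π_mem_cstar hα e) hx

theorem mul_T_mem_cstar (h : R.IsRep α) {x : R.H →L[ℂ] R.H} (hx : x ∈ R.cstar) :
    x * R.T ∈ R.cstar := by
  obtain ⟨l, hl, hl', hr, he⟩ := CStarAux.exists_approx A
  refine (isClosed_cstarGen _).mem_of_tendsto
    ((h.tendsto_mul_π hr (he.mono fun e h => ⟨h.1, h.2.1⟩) hx).mul_const R.T)
    (Eventually.of_forall fun e => ?_)
  rw [mul_assoc]
  exact R.cstar.mul_mem hx (R.cstarπT e).2

theorem mul_star_T_mem_cstar (h : R.IsRep α) (hα : IsExtendible α) {x : R.H →L[ℂ] R.H}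
    (hx : x ∈ R.cstar) : x * star R.T ∈ R.cstar := by
  have := star_mem (h.T_mul_mem_cstar hα (star_mem hx))
  rwa [star_mul, star_star] at this

end OpRep.IsRep

end Extendible

/-! ### The multiplier `s` -/

section Multiplier

/-- An operator multiplying a concrete `C⋆`-algebra into itself defines a multiplier. -/
theorem exists_doubleCentralizer {B : Type u} [NonUnitalCStarAlgebra B] {H : Type v}
    [NormedAddCommGroup H] [InnerProductSpace ℂ H] [CompleteSpace H]
    {C : NonUnitalStarSubalgebra ℂ (H →L[ℂ] H)} [IsClosed (C : Set (H →L[ℂ] H))] (Ψ : B ≃⋆ₐ[ℂ] C)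
    {T : H →L[ℂ] H} (hl : ∀ x ∈ C, T * x ∈ C) (hr : ∀ x ∈ C, x * T ∈ C) :
    ∃ s : 𝓜(ℂ, B), (∀ q, (Ψ (s.fst q) : H →L[ℂ] H) = T * Ψ q) ∧
      ∀ q, (Ψ (s.snd q) : H →L[ℂ] H) = Ψ q * T := by
  have h1 : ∀ q, ∃ p, (Ψ p : H →L[ℂ] H) = T * Ψ q := fun q => by
    obtain ⟨p, hp⟩ := Ψ.surjective ⟨_, hl _ (Ψ q).2⟩
    exact ⟨p, congrArg Subtype.val hp⟩
  have h2 : ∀ q, ∃ p, (Ψ p : H →L[ℂ] H) = Ψ q * T := fun q => by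
    obtain ⟨p, hp⟩ := Ψ.surjective ⟨_, hr _ (Ψ q).2⟩
    exact ⟨p, congrArg Subtype.val hp⟩
  choose L hL using h1
  choose M hM using h2
  have hinj : ∀ {p q : B}, (Ψ p : H →L[ℂ] H) = Ψ q → p = q := fun h =>
    Ψ.injective (Subtype.ext h)
  have hadd : ∀ p q, (Ψ (p + q) : H →L[ℂ] H) = Ψ p + Ψ q := fun p q =>
    congrArg Subtype.val (map_add Ψ p q)
  have hmul : ∀ p q, (Ψ (p * q) : H →L[ℂ] H) = Ψ p * Ψ q := fun p q =>
    congrArg Subtype.val (map_mul Ψ p q)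
  have hsmul : ∀ (c : ℂ) p, (Ψ (c • p) : H →L[ℂ] H) = c • (Ψ p : H →L[ℂ] H) := fun c p =>
    congrArg Subtype.val (map_smul Ψ c p)
  have hn : ∀ q, ‖q‖ = ‖(Ψ q : H →L[ℂ] H)‖ := fun q => (StarAlgEquiv.norm_map Ψ q).symm
  let L' : B →ₗ[ℂ] B :=
    { toFun := L
      map_add' := fun x y => hinj (by rw [hL, hadd, hadd, hL, hL, mul_add])
      map_smul' := fun c x => hinj (by rw [hL, hsmul, RingHom.id_apply, hsmul, hL, mul_smul_comm]) }
  let M' : B →ₗ[ℂ] B :=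
    { toFun := M
      map_add' := fun x y => hinj (by rw [hM, hadd, hadd, hM, hM, add_mul])
      map_smul' := fun c x => hinj (by rw [hM, hsmul, RingHom.id_apply, hsmul, hM, smul_mul_assoc]) }
  have hL' : ∀ q, ‖L' q‖ ≤ ‖T‖ * ‖q‖ := fun q => by
    have h3 : ‖L' q‖ = ‖T * (Ψ q : H →L[ℂ] H)‖ := (hn (L q)).trans (congrArg norm (hL q))
    rw [h3, hn q]
    exact norm_mul_le _ _
  have hM' : ∀ q, ‖M' q‖ ≤ ‖T‖ * ‖q‖ := fun q => by
    have h3 : ‖M' q‖ = ‖(Ψ q : H →L[ℂ] H) * T‖ := (hn (M q)).trans (congrArg norm (hM q))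
    rw [h3, hn q, mul_comm ‖T‖]
    exact norm_mul_le _ _
  have hc : ∀ x y, M x * y = x * L y := fun x y => hinj (by
    rw [hmul, hmul, hM, hL, mul_assoc])
  exact ⟨⟨(L'.mkContinuous ‖T‖ hL', M'.mkContinuous ‖T‖ hM'), hc⟩, hL, hM⟩

variable {A : Type u} [NonUnitalCStarAlgebra A] {α : A →⋆ₙₐ[ℂ] A} {J : Set A}

theorem IsMultiplierS.jA_mul_fst {s : 𝓜(ℂ, CrossedProduct α J)} (hs : IsMultiplierS α J s) (a : A)
    (q : CrossedProduct α J) : jA α J a * s.fst q = jAs α J a * q :=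
  DFunLike.congr_fun (congrArg (fun m : 𝓜(ℂ, CrossedProduct α J) => m.fst) (hs a)) q

/-- After multiplication by `π(a)`, both sides become `π(a)S Ψ(q)`; nondegeneracy removes `π(a)`. So
the defining relation on the elements `j_A(a)` determines left multiplication by `s` in every
generating pair. -/
theorem IsMultiplierS.map_fst {s : 𝓜(ℂ, CrossedProduct α J)} (hs : IsMultiplierS α J s)
    {R : OpRep.{u, v} A} {Ψ : CrossedProduct α J ≃⋆ₐ[ℂ] R.cstar} (hΨ : Generates α J R Ψ)
    (q : CrossedProduct α J) : (Ψ (s.fst q) : R.H →L[ℂ] R.H) = R.T * Ψ q := by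
  refine R.ext_of_π_mul fun a => ?_
  have h1 := congrArg (fun q => (Ψ q : R.H →L[ℂ] R.H)) (hs.jA_mul_fst a q)
  simp only [map_mul, hΨ.2.1, hΨ.2.2] at h1
  exact h1.trans (mul_assoc _ _ _)

theorem IsMultiplierS.map_snd {s : 𝓜(ℂ, CrossedProduct α J)} (hs : IsMultiplierS α J s)
    {R : OpRep.{u, v} A} {Ψ : CrossedProduct α J ≃⋆ₐ[ℂ] R.cstar} (hΨ : Generates α J R Ψ)
    (q : CrossedProduct α J) : (Ψ (s.snd q) : R.H →L[ℂ] R.H) = Ψ q * R.T := by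
  refine R.ext_of_mul_π fun a => ?_
  -- The double centralizer identity `(q s) j_A(a) = q (s j_A(a))` reduces right multiplication to
  -- left multiplication.
  have h1 := congrArg (fun q => (Ψ q : R.H →L[ℂ] R.H)) (s.central q (jA α J a))
  simp only [map_mul, hΨ.2.1] at h1
  refine h1.trans ?_
  change (Ψ q : R.H →L[ℂ] R.H) * (Ψ (s.fst (jA α J a)) : R.H →L[ℂ] R.H) = _
  rw [hs.map_fst hΨ, hΨ.2.1, ← mul_assoc]
  rfl

theorem exists_isMultiplierS (hα : IsExtendible α) (J : Set A) :
    ∃ s : 𝓜(ℂ, CrossedProduct α J), IsMultiplierS α J s := by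
  obtain ⟨W, hW⟩ := OpRep.exists_isUniversal_isRepFixing α J
  obtain ⟨Ψ, hT, h1, h2⟩ := exists_generates_of_isUniversal hW
  obtain ⟨s, hL, hM⟩ := exists_doubleCentralizer Ψ (fun x hx => hT.T_mul_mem_cstar hα hx)
    (fun x hx => hT.mul_T_mem_cstar hx)
  refine ⟨s, fun a => DoubleCentralizer.ext _ _ _ _ (Prod.ext ?_ ?_)⟩
  · refine ContinuousLinearMap.ext fun q => Ψ.injective (Subtype.ext ?_)
    have h3 : (Ψ (jA α J a * s.fst q) : W.H →L[ℂ] W.H) = Ψ (jAs α J a * q) := by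
      rw [map_mul, map_mul, h1, h2, MulMemClass.coe_mul, MulMemClass.coe_mul, hL]
      exact (mul_assoc _ _ _).symm
    exact h3
  · refine ContinuousLinearMap.ext fun q => Ψ.injective (Subtype.ext ?_)
    have h3 : (Ψ (s.snd (q * jA α J a)) : W.H →L[ℂ] W.H) = Ψ (q * jAs α J a) := by
      rw [hM, map_mul, map_mul, h1, h2]
      exact mul_assoc _ _ _
    exact h3

theorem IsMultiplierS.cstarGen_eq_top {s : 𝓜(ℂ, CrossedProduct α J)} (hs : IsMultiplierS α J s) :
    cstarGen (Set.range (jA α J) ∪ Set.range fun a => s.fst (jA α J a)) = ⊤ := by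
  obtain ⟨W, hW⟩ := OpRep.exists_isUniversal_isRepFixing α J
  obtain ⟨Ψ, hΨ⟩ := exists_generates_of_isUniversal hW
  -- The commutation `π(a)S = Sπ(α(a))`, transported to the crossed product, expresses the old
  -- generators by the new ones.
  have h1 : ∀ a, jAs α J a = s.fst (jA α J (α a)) := fun a => by
    have h2 := hs.map_fst hΨ (jA α J (α a))
    rw [hΨ.2.1] at h2
    refine Ψ.injective (Subtype.ext (Eq.trans ?_ h2.symm))
    exact (congrArg Subtype.val (hΨ.2.2 a)).trans (hΨ.1.π_mul_T a)
  rw [eq_top_iff, ← cstarGen_crossedProduct]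
  refine cstarGen_le ?_ (isClosed_cstarGen _)
  rintro _ (⟨a, rfl⟩ | ⟨a, rfl⟩)
  · exact subset_cstarGen _ (Or.inl ⟨a, rfl⟩)
  · rw [h1]
    exact subset_cstarGen _ (Or.inr ⟨α a, rfl⟩)

end Multiplier

theorem NonUnitalStarSubalgebra.exists_restrict {B C : Type*} [NonUnitalCStarAlgebra B]
    [NonUnitalCStarAlgebra C] {S S' : NonUnitalStarSubalgebra ℂ B} {D D' : NonUnitalStarSubalgebra ℂ C}
    (hS : S' ≤ S) (hD : D ≤ D') (f : S →⋆ₙₐ[ℂ] D) :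
    ∃ g : S' →⋆ₙₐ[ℂ] D', ∀ x y (hx : x ∈ S) (hx' : x ∈ S'), (f ⟨x, hx⟩ : C) = y → (g ⟨x, hx'⟩ : C) = y :=
  ⟨((inclusion hD).comp f).comp (inclusion hS), fun _ _ _ _ h => h⟩

/-! ### Passing from `(π,U)` to `(π,U⋆)` -/

namespace OpRep

variable {A : Type u} [NonUnitalCStarAlgebra A] {α : A →⋆ₙₐ[ℂ] A} {J : Set A}

/-- The pair `(π, T⋆)`. -/
noncomputable abbrev flip (R : OpRep.{u, v} A) : OpRep.{u, v} A where
  H := R.H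
  π := R.π
  nondegenerate := R.nondegenerate
  T := star R.T

theorem isRep_flip {R : OpRep.{u, v} A} : R.flip.IsRep α ↔ R.IsEndoRep α := by
  simp only [IsRep, IsEndoRep, flip, star_star]

theorem isEndoCovariant_flip {R : OpRep.{u, v} A} :
    R.flip.IsEndoCovariant α J ↔ R.IsRepFixing α J := by
  simp only [IsRepFixing, IsRep, IsEndoCovariant, IsEndoRep, flip, star_star]

theorem isRepFixing_flip {R : OpRep.{u, v} A} :
    R.flip.IsRepFixing α J ↔ R.IsEndoCovariant α J := by
  simp only [IsRepFixing, IsRep, IsEndoCovariant, IsEndoRep, flip, star_star]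

theorem full_flip_le (R : OpRep.{u, v} A) : R.flip.full ≤ R.full := by
  refine cstarGen_le ?_ (isClosed_cstarGen _)
  rintro _ (⟨a, rfl⟩ | rfl)
  · exact (R.fullπ a).2
  · exact (star R.fullT).2

theorem Below.of_flip {R W : OpRep.{u, v} A} (h : R.flip.Below W) : R.Below W.flip := by
  obtain ⟨f, h1, h2⟩ := h
  obtain ⟨g, hg⟩ := NonUnitalStarSubalgebra.exists_restrict W.full_flip_le R.full_flip_le f
  refine ⟨g, fun a => Subtype.ext ?_, Subtype.ext ?_⟩
  · refine hg _ _ (W.fullπ a).2 _ ?_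
    exact congrArg Subtype.val (h1 a)
  · refine hg _ _ (star W.fullT).2 _ ?_
    have h3 : f (star W.fullT) = star R.flip.fullT := by rw [map_star, h2]
    have h4 : ((star R.flip.fullT : R.flip.full) : R.H →L[ℂ] R.H) = R.T := star_star R.T
    exact (congrArg Subtype.val h3).trans h4

theorem IsUniversal.flip {W : OpRep.{u, v} A} (h : IsUniversal (IsEndoCovariant α J) W) :
    IsUniversal (IsRepFixing α J) W.flip :=
  ⟨isRepFixing_flip.mpr h.1, fun R hR => (h.2 R.flip (isEndoCovariant_flip.mpr hR)).of_flip⟩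

theorem IsUniversal.congr {P Q : OpRep.{u, v} A → Prop} (h : ∀ R, P R ↔ Q R) {W : OpRep.{u, v} A}
    (hW : IsUniversal P W) : IsUniversal Q W :=
  ⟨(h W).mp hW.1, fun R hR => hW.2 R ((h R).mpr hR)⟩

/-- If `U⋆U` fixes all of `π(A)`, nondegeneracy gives `U⋆U = 1`. -/
theorem isIsometric_iff {R : OpRep.{u, v} A} :
    R.IsIsometric α ↔ R.IsEndoCovariant α Set.univ := by
  refine and_congr_right fun _ => ⟨fun h a _ => ?_, fun h => R.ext_of_mul_π fun a => ?_⟩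
  · change star R.T * R.T * R.π a = R.π a
    rw [h, one_mul]
  · exact (h (Set.mem_univ a)).trans (one_mul _).symm

/-- Covariance for `{0}` is vacuous, and the partial-isometry and commutation conditions hold
automatically, by the algebra of `S = U⋆`. -/
theorem isPartialIsometric_iff {R : OpRep.{u, v} A} :
    R.IsPartialIsometric α ↔ R.IsEndoCovariant α {0} := by
  refine and_congr_right fun h => ⟨fun _ a ha => ?_, fun _ => ?_⟩
  · obtain rfl : a = 0 := ha
    change star R.T * R.T * R.π 0 = R.π 0
    rw [map_zero, mul_zero]
  · have h1 : R.flip.IsRep α := isRep_flip.mpr h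
    have h2 := congrArg star h1.T_mul_star_T_mul_T
    have h3 := fun a => (h1.π_mul_T_mul_star_T a).symm
    simp only [flip, star_mul, star_star] at h2 h3
    exact ⟨by rw [mul_assoc]; exact h2, h3⟩

/-- One inclusion is `π(a)U⋆ = U⋆π(α(a)) = (π(α(a)⋆)U)⋆`. The other needs `π(a)U` in `C⋆(π,U⋆)`,
which is where extendibility is used. -/
theorem IsEndoRep.flip_cstar {R : OpRep.{u, v} A} (h : R.IsEndoRep α) (hα : IsExtendible α) :
    R.flip.cstar = R.cstar := by
  have h1 : R.flip.IsRep α := isRep_flip.mpr h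
  refine le_antisymm (cstarGen_le ?_ (isClosed_cstarGen _)) (cstarGen_le ?_ (isClosed_cstarGen _))
  · rintro _ (⟨a, rfl⟩ | ⟨a, rfl⟩)
    · exact (R.cstarπ a).2
    · rw [h1.π_mul_T]
      have := (star (R.cstarπT (star (α a)))).2
      change star (R.π (star (α a)) * R.T) ∈ R.cstar at this
      rwa [star_mul, ← map_star, star_star] at this
  · rintro _ (⟨a, rfl⟩ | ⟨a, rfl⟩)
    · exact (R.flip.cstarπ a).2
    · have := h1.mul_star_T_mem_cstar hα (R.flip.cstarπ a).2
      change R.π a * star (star R.T) ∈ R.flip.cstar at this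
      rwa [star_star] at this

theorem IsEndoRep.flip_cstar_eq_words {R : OpRep.{u, v} A} (h : R.IsEndoRep α)
    (hα : IsExtendible α) :
    R.flip.cstar = cstarGen {x | ∃ (a : A) (n m : ℕ), R.π a * R.T ^ n * star R.T ^ m = x} := by
  have h1 : R.flip.IsRep α := isRep_flip.mpr h
  refine le_antisymm (cstarGen_le ?_ (isClosed_cstarGen _)) (cstarGen_le ?_ (isClosed_cstarGen _))
  · rintro _ (⟨a, rfl⟩ | ⟨a, rfl⟩)
    · exact subset_cstarGen _ ⟨a, 0, 0, by simp⟩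
    · exact subset_cstarGen _ ⟨a, 0, 1, by simp⟩
  · rintro _ ⟨a, n, m, rfl⟩
    -- With `S = U⋆`, each factor `U = S⋆` on the right is absorbed by extendibility; the factors
    -- `U⋆ = S` treated afterwards are absorbed without it.
    have h2 : R.π a * R.T ^ n ∈ R.flip.cstar := by
      induction n with
      | zero => rw [pow_zero, mul_one]; exact (R.flip.cstarπ a).2
      | succ n ih =>
        have := h1.mul_star_T_mem_cstar hα ih
        rw [pow_succ, ← mul_assoc]
        simpa only [flip, star_star] using this
    induction m with
    | zero => rwa [pow_zero, mul_one]
    | succ m ih =>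
      rw [pow_succ, ← mul_assoc]
      exact h1.mul_T_mem_cstar ih

/-- The two generating sets are adjoint to each other, since `(Uπ(a))⋆ = π(a⋆)U⋆`; no covariance
relation is involved. -/
theorem flip_cstar_eq_cstarGen_T_mul (R : OpRep.{u, v} A) :
    R.flip.cstar = cstarGen (Set.range R.π ∪ {x | ∃ a, R.T * R.π a = x}) := by
  refine le_antisymm (cstarGen_le ?_ (isClosed_cstarGen _)) (cstarGen_le ?_ (isClosed_cstarGen _))
  · rintro _ (⟨a, rfl⟩ | ⟨a, rfl⟩)
    · exact subset_cstarGen _ (Or.inl ⟨a, rfl⟩)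
    · have := star_mem (subset_cstarGen (Set.range R.π ∪ {x | ∃ a, R.T * R.π a = x})
        (Or.inr ⟨star a, rfl⟩))
      rwa [star_mul, ← map_star, star_star] at this
  · rintro _ (⟨a, rfl⟩ | ⟨a, rfl⟩)
    · exact (R.flip.cstarπ a).2
    · have := (star (R.flip.cstarπT (star a))).2
      change star (R.π (star a) * star R.T) ∈ R.flip.cstar at this
      rwa [star_mul, ← map_star, star_star, star_star] at this

end OpRep

/-! ### Identification with the crossed products of endomorphisms -/

section CrossedProducts

variable {A : Type u} [NonUnitalCStarAlgebra A] {α : A →⋆ₙₐ[ℂ] A} {J : Set A}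

/-- The flipped pair `(i_A, u⋆)` is universal for the fixing condition, hence generates the crossed
product, and there `s` acts as `u⋆`. All four isomorphisms are instances, differing in `J` and in
the description of `B`. -/
theorem IsMultiplierS.establishIso {s : 𝓜(ℂ, CrossedProduct α J)} (hs : IsMultiplierS α J s)
    {W : OpRep.{u, u} A} (hW : OpRep.IsUniversal (OpRep.IsEndoCovariant α J) W)
    {B : NonUnitalStarSubalgebra ℂ (W.H →L[ℂ] W.H)} (hB : W.flip.cstar = B) :
    EstablishIso α J s W B := by
  subst hB
  obtain ⟨Ψ, hΨ⟩ := exists_generates_of_isUniversal hW.flip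
  refine ⟨Ψ, fun a => congrArg Subtype.val (hΨ.2.1 a), fun a => ?_⟩
  rw [hs.map_fst hΨ, hΨ.2.1]
  rfl

/-- By the `C⋆`-identity, membership in `N_α` means `α(ab) = 0` for all `b`; an approximate unit in
place of `b` gives `α(a) = 0`. -/
theorem gnsKernel_eq_kerSet (α : A →⋆ₙₐ[ℂ] A) : gnsKernel α = kerSet α := by
  ext a
  constructor
  · intro h
    obtain ⟨l, hl, hl', -, -⟩ := CStarAux.exists_approx A
    refine tendsto_nhds_unique ((α.continuous_of_cstar.tendsto a).comp (hl' a)) ?_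
    refine tendsto_const_nhds.congr fun e => ?_
    have := h e
    rw [map_mul, map_star, CStarRing.star_mul_self_eq_zero_iff] at this
    exact this.symm
  · intro h b
    have h0 : α a = 0 := h
    rw [map_mul, map_mul α a b, h0, zero_mul, mul_zero]

theorem isUniversal_endoRep (α : A →⋆ₙₐ[ℂ] A) (J : Set A) :
    OpRep.IsUniversal (OpRep.IsEndoCovariant α J) (endoRep α J) :=
  (OpRep.exists_isUniversal_isEndoCovariant α J).choose_spec

theorem isUniversal_staceyRep (α : A →⋆ₙₐ[ℂ] A) :
    OpRep.IsUniversal (OpRep.IsEndoCovariant α Set.univ) (staceyRep α) :=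
  (OpRep.exists_isUniversal_isIsometric α).choose_spec.congr fun _ => OpRep.isIsometric_iff

theorem isUniversal_partialIsometricRep (α : A →⋆ₙₐ[ℂ] A) :
    OpRep.IsUniversal (OpRep.IsEndoCovariant α {0}) (partialIsometricRep α) :=
  (OpRep.exists_isUniversal_isPartialIsometric α).choose_spec.congr fun _ =>
    OpRep.isPartialIsometric_iff

theorem IsMultiplierS.establishIso_endo (hα : IsExtendible α) {s : 𝓜(ℂ, CrossedProduct α J)}
    (hs : IsMultiplierS α J s) : EstablishIso α J s (endoRep α J) (cstarEndo α J) :=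
  hs.establishIso (isUniversal_endoRep α J) ((isUniversal_endoRep α J).1.1.flip_cstar hα)

end CrossedProducts

theorem mainTheorem9 {A : Type u} [NonUnitalCStarAlgebra A] (α : A →⋆ₙₐ[ℂ] A)
    (J : ClosedIdeal A) :
    (∀ R : OpRep.{u, v} A, R.IsRep α →
      (R.IsCovariant α J ↔ (J : Set A) ⊆ {a | R.T * star R.T * R.π a = R.π a})) ∧
    ((∃ W : OpRep.{u, u} A, OpRep.IsUniversal (OpRep.IsRepFixing α J) W) ∧
      (∀ W : OpRep.{u, u} A, OpRep.IsUniversal (OpRep.IsRepFixing α J) W →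
        ∃ Ψ : CrossedProduct α J ≃⋆ₐ[ℂ] W.cstar, Generates α J W Ψ) ∧
      (∀ (R : OpRep.{u, v} A) (Ψ : CrossedProduct α J ≃⋆ₐ[ℂ] R.cstar),
        Generates α J R Ψ → R.IsRepFixing α J) ∧
      (∀ R : OpRep.{u, u} A, R.IsRepFixing α J →
        ∃! Φ : CrossedProduct α J →⋆ₙₐ[ℂ] R.cstar,
          (∀ a, Φ (jA α J a) = R.cstarπ a) ∧ ∀ a, Φ (jAs α J a) = R.cstarπT a) ∧
      cstarGen (Set.range (jA α (J : Set A)) ∪ Set.range (jAs α (J : Set A))) = ⊤) ∧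
    (IsExtendible α →
      (∃ s : 𝓜(ℂ, CrossedProduct α J), IsMultiplierS α J s ∧
        (∀ (R : OpRep.{u, v} A) (Ψ : CrossedProduct α J ≃⋆ₐ[ℂ] R.cstar), Generates α J R Ψ →
          ∀ q, (Ψ (s.fst q) : R.H →L[ℂ] R.H) = R.T * Ψ q ∧
            (Ψ (s.snd q) : R.H →L[ℂ] R.H) = Ψ q * R.T) ∧
        cstarGen (Set.range (jA α (J : Set A)) ∪
          Set.range fun a => s.fst (jA α (J : Set A) a)) = ⊤ ∧
        EstablishIso α J s (endoRep α J) (cstarEndo α J)) ∧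
      (∃ s : 𝓜(ℂ, CrossedProduct α (annihilatorSet (gnsKernel α))),
        IsMultiplierS α (annihilatorSet (gnsKernel α)) s ∧
        EstablishIso α (annihilatorSet (gnsKernel α)) s
          (endoRep α (annihilatorSet (kerSet α))) (cstarEndo α (annihilatorSet (kerSet α)))) ∧
      (∃ s : 𝓜(ℂ, CrossedProduct α Set.univ), IsMultiplierS α Set.univ s ∧
        EstablishIso α Set.univ s (staceyRep α) (staceyProduct α)) ∧
      (∃ s : 𝓜(ℂ, CrossedProduct α {0}), IsMultiplierS α {0} s ∧
        EstablishIso α {0} s (partialIsometricRep α) (partialIsometricProduct α))) := by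
  refine ⟨fun R hR => hR.isCovariant_iff _, ⟨OpRep.exists_isUniversal_isRepFixing α J,
    fun W hW => exists_generates_of_isUniversal hW, fun R Ψ hΨ => hΨ.isRepFixing,
    fun R hR => hR.existsUnique_hom, cstarGen_crossedProduct α J⟩, fun hα => ⟨?_, ?_, ?_, ?_⟩⟩
  · obtain ⟨s, hs⟩ := exists_isMultiplierS hα (J : Set A)
    exact ⟨s, hs, fun R Ψ hΨ q => ⟨hs.map_fst hΨ q, hs.map_snd hΨ q⟩, hs.cstarGen_eq_top,
      hs.establishIso_endo hα⟩
  · rw [gnsKernel_eq_kerSet]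
    obtain ⟨s, hs⟩ := exists_isMultiplierS hα (annihilatorSet (kerSet α))
    exact ⟨s, hs, hs.establishIso_endo hα⟩
  · obtain ⟨s, hs⟩ := exists_isMultiplierS hα Set.univ
    exact ⟨s, hs, hs.establishIso (isUniversal_staceyRep α)
      ((isUniversal_staceyRep α).1.1.flip_cstar_eq_words hα)⟩
  · obtain ⟨s, hs⟩ := exists_isMultiplierS hα {0}
    exact ⟨s, hs, hs.establishIso (isUniversal_partialIsometricRep α)
      (partialIsometricRep α).flip_cstar_eq_cstarGen_T_mul⟩
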